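/- Let $n\ge 3$, let $(M^n,g)$ be a smooth Riemannian manifold (completeness is not needed), let $m,\lambda\in\mathbb R$ with $m\neq 0,1$, and let $f:M\to\mathbb R$ be a smooth function satisfying the $(\lambda,n+m)$-Einstein equation $$\mathrm{Ric}+\mathrm{Hess}\,f-\frac1m\,df\otimes df=\lambda g .$$ Define the $3$-tensor $D$ by $$\begin{aligned}D(X,Y,Z)=\;&\frac{1}{(n-1)(n-2)}\big(\mathrm{Ric}(X,\nabla f)\,g(Y,Z)-\mathrm{Ric}(Y,\nabla f)\,g(X,Z)\big)\\&+\frac{1}{n-2}\big(\mathrm{Ric}(Y,Z)\,g(X,\nabla f)-\mathrm{Ric}(X,Z)\,g(Y,\nabla f)\big)\\&-\frac{\mathrm{scal}}{(n-1)(n-2)}\big(g(X,\nabla f)\,g(Y,Z)-g(Y,\nabla f)\,g(X,Z)\big).\end{aligned}$$ Let $p\in M$ be a point with $\nabla f(p)\ne 0$, let $\Sigma$ be the level set of $f$ through $p$ (a smooth hypersurface near $p$), and let $\nu=\nabla f/|\nabla f|$. Let $e_1,\dots,e_n$ be an orthonormal basis of $T_pM$ and $\varepsilon_2,\dots,\varepsilon_n$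 an orthonormal basis of $T_p\Sigma=\ker df_p$. Let $h_{ab}=g(\nabla_{\varepsilon_a}\nu,\varepsilon_b)$ be the second fundamental form of $\Sigma$ at $p$, $H=\sum_{a=2}^n h_{aa}=(n-1)\sigma$ its mean curvature, and $g_{ab}=g(\varepsilon_a,\varepsilon_b)$. Then at $p$, with $|D|^2=\sum_{i,j,k=1}^n D(e_i,e_j,e_k)^2$, $$|D|^2=\frac{2|\nabla f|^4}{(n-2)^2}\sum_{a,b=2}^n\left|h_{ab}-\sigma g_{ab}\right|^2+\frac{m^2}{2(n-1)(n-2)(m-1)^2}\left|\nabla^\Sigma\mathrm{scal}\right|^2,$$ where $\left|\nabla^\Sigma\mathrm{scal}\right|^2=|\nabla\mathrm{scal}|^2-g\!\left(\nabla\mathrm{scal},\frac{\nabla f}{|\nabla f|}\right)^2$. -/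

import Mathlib

open scoped Manifold ContDiff Bundle

noncomputable section

/-! ## Riemannian geometry in local coordinates

A metric on an open subset of `ℝⁿ` is given by its matrix of components
`G x = (g_{ij}(x))`; tangent vectors at `x` are given by their components `Fin n → ℝ`
with respect to the coordinate frame `∂_1, …, ∂_n`. All quantities below are the usual
coordinate expressions of the corresponding geometric objects. -/
namespace Coord

variable {n : ℕ}

/-- The partial derivative `∂_i u` at `x`. -/
def pd (i : Fin n) (u : EuclideanSpace ℝ (Fin n) → ℝ) (x : EuclideanSpace ℝ (Fin n)) : ℝ :=
  fderiv ℝ u x (EuclideanSpace.single i 1)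

variable (G : EuclideanSpace ℝ (Fin n) → Matrix (Fin n) (Fin n) ℝ)

/-- The scalar product `g(v, w) = g_{ij} v^i w^j` at `x`. -/
def ip (x : EuclideanSpace ℝ (Fin n)) (v w : Fin n → ℝ) : ℝ :=
  ∑ i, ∑ j, G x i j * v i * w j

/-- The Christoffel symbol `Γ^k_{ij} = ½ g^{kl} (∂_i g_{jl} + ∂_j g_{il} - ∂_l g_{ij})`
of the Levi-Civita connection. -/
def christoffel (k i j : Fin n) (x : EuclideanSpace ℝ (Fin n)) : ℝ :=
  (1 / 2 : ℝ) * ∑ l, (G x)⁻¹ k l *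
    (pd i (fun y => G y j l) x + pd j (fun y => G y i l) x - pd l (fun y => G y i j) x)

/-- The Riemann curvature, `R(∂_i, ∂_j) ∂_k = ∑_l (riemann i j k l) ∂_l`, where
`R(X, Y) Z = ∇_X ∇_Y Z - ∇_Y ∇_X Z - ∇_{[X, Y]} Z`; thus `g(R(X, Y) Y, X)` has the sign of
the sectional curvature. -/
def riemann (i j k l : Fin n) (x : EuclideanSpace ℝ (Fin n)) : ℝ :=
  pd i (christoffel G l j k) x - pd j (christoffel G l i k) x
    + ∑ s, (christoffel G l i s x * christoffel G s j k x
      - christoffel G l j s x * christoffel G s i k x)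

/-- The components `Ric_{jk}` of the Ricci tensor `Ric(Y, Z) = tr (X ↦ R(X, Y) Z)`. -/
def ricciComp (j k : Fin n) (x : EuclideanSpace ℝ (Fin n)) : ℝ :=
  ∑ i, riemann G i j k i x

/-- The Ricci tensor `Ric(v, w)` at `x`. -/
def ricci (x : EuclideanSpace ℝ (Fin n)) (v w : Fin n → ℝ) : ℝ :=
  ∑ j, ∑ k, ricciComp G j k x * v j * w k

/-- The scalar curvature `g^{jk} Ric_{jk}`. -/
def scal (x : EuclideanSpace ℝ (Fin n)) : ℝ :=
  ∑ j, ∑ k, (G x)⁻¹ j k * ricciComp G j k x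

/-- The components `∂_i ∂_j u - Γ^k_{ij} ∂_k u` of the Hessian of `u`. -/
def hessComp (u : EuclideanSpace ℝ (Fin n) → ℝ) (i j : Fin n)
    (x : EuclideanSpace ℝ (Fin n)) : ℝ :=
  pd i (pd j u) x - ∑ k, christoffel G k i j x * pd k u x

/-- The gradient `(∇u)^i = g^{ij} ∂_j u`. -/
def grad (u : EuclideanSpace ℝ (Fin n) → ℝ) (x : EuclideanSpace ℝ (Fin n)) : Fin n → ℝ :=
  fun i => ∑ j, (G x)⁻¹ i j * pd j u x

/-- The norm `|v| = √g(v, v)` at `x`. -/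
def norm (x : EuclideanSpace ℝ (Fin n)) (v : Fin n → ℝ) : ℝ :=
  √(ip G x v v)

/-- The covariant derivative `(∇_v N)^k = v^i (∂_i N^k + Γ^k_{ij} N^j)` of a vector field `N`. -/
def covDeriv (N : EuclideanSpace ℝ (Fin n) → Fin n → ℝ) (x : EuclideanSpace ℝ (Fin n))
    (v : Fin n → ℝ) : Fin n → ℝ :=
  fun k => ∑ i, v i * (pd i (fun y => N y k) x + ∑ j, christoffel G k i j x * N x j)

/-- The unit normal `∇u / |∇u|` of the level sets of `u` (at regular points of `u`). -/
def unitNormal (u : EuclideanSpace ℝ (Fin n) → ℝ) (x : EuclideanSpace ℝ (Fin n)) :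
    Fin n → ℝ :=
  fun k => grad G u x k / norm G x (grad G u x)

/-- The second fundamental form `h(v, w) = g(∇_v ν, w)`, `ν = ∇u / |∇u|`, of the level set of
`u` through `x`, for `v`, `w` tangent to that level set. -/
def secondFF (u : EuclideanSpace ℝ (Fin n) → ℝ) (x : EuclideanSpace ℝ (Fin n))
    (v w : Fin n → ℝ) : ℝ :=
  ip G x (covDeriv G (unitNormal G u) x v) w

/-- The tensor `D(X, Y, Z)` of `(g, u)`. -/
def dTensor (u : EuclideanSpace ℝ (Fin n) → ℝ) (x : EuclideanSpace ℝ (Fin n))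
    (X Y Z : Fin n → ℝ) : ℝ :=
  1 / (((n : ℝ) - 1) * ((n : ℝ) - 2)) *
      (ricci G x X (grad G u x) * ip G x Y Z - ricci G x Y (grad G u x) * ip G x X Z)
    + 1 / ((n : ℝ) - 2) *
      (ricci G x Y Z * ip G x X (grad G u x) - ricci G x X Z * ip G x Y (grad G u x))
    - scal G x / (((n : ℝ) - 1) * ((n : ℝ) - 2)) *
      (ip G x X (grad G u x) * ip G x Y Z - ip G x Y (grad G u x) * ip G x X Z)

/-- A family of vectors that is orthonormal at `x` for the metric `G`. -/
def IsOrthonormal {k : ℕ} (x : EuclideanSpace ℝ (Fin n)) (e : Fin k → Fin n → ℝ) : Prop :=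
  ∀ a b, ip G x (e a) (e b) = if a = b then 1 else 0

/-- `v` is tangent at `x` to the level set `{u = u(x)}`, i.e. `du_x(v) = 0`
(to be used at regular points of `u`). -/
def IsTangent (u : EuclideanSpace ℝ (Fin n) → ℝ) (x : EuclideanSpace ℝ (Fin n))
    (v : Fin n → ℝ) : Prop :=
  ∑ i, pd i u x * v i = 0

end Coord

section Manifold

variable {n : ℕ} {M : Type*} [TopologicalSpace M]
  [ChartedSpace (EuclideanSpace ℝ (Fin n)) M] [IsManifold (𝓡 n) ∞ M]

/-- The components `g_{ij} = g(∂_i, ∂_j)` of a Riemannian metric in the chart `φ`, as functions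
on `φ.target`; here `∂_i` is the image of the `i`-th standard basis vector under the
differential of `φ⁻¹`. -/
def metricInChart
    (g : Bundle.ContMDiffRiemannianMetric (𝓡 n) ∞ (EuclideanSpace ℝ (Fin n))
      (fun q : M => TangentSpace (𝓡 n) q))
    (φ : OpenPartialHomeomorph M (EuclideanSpace ℝ (Fin n))) (x : EuclideanSpace ℝ (Fin n)) :
    Matrix (Fin n) (Fin n) ℝ :=
  Matrix.of fun i j => g.inner (φ.symm x)
    (mfderiv (𝓡 n) (𝓡 n) φ.symm x (EuclideanSpace.single i (1 : ℝ)))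
    (mfderiv (𝓡 n) (𝓡 n) φ.symm x (EuclideanSpace.single j (1 : ℝ)))

/-- The `(lam, n + m)`-Einstein equation `Ric + Hess f - (1/m) df ⊗ df = lam g` on `M`: the
equation of `(0,2)`-tensors holds componentwise on the whole of every smooth chart. -/
def SatisfiesEinsteinEquation
    (g : Bundle.ContMDiffRiemannianMetric (𝓡 n) ∞ (EuclideanSpace ℝ (Fin n))
      (fun q : M => TangentSpace (𝓡 n) q))
    (f : M → ℝ) (lam m : ℝ) : Prop :=
  ∀ φ ∈ IsManifold.maximalAtlas (𝓡 n) ∞ M, ∀ x ∈ φ.target, ∀ i j : Fin n,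
    Coord.ricciComp (metricInChart g φ) i j x
      + Coord.hessComp (metricInChart g φ) (f ∘ φ.symm) i j x
      - 1 / m * (Coord.pd i (f ∘ φ.symm) x * Coord.pd j (f ∘ φ.symm) x)
    = lam * metricInChart g φ x i j

end Manifold

end

/-! Everything happens at one point once a differential identity is known. Taking the divergence of
the Einstein equation, with the contracted Bianchi identity (`divMixed_ricci`) and the Bochner
commutation (`divMixed_covDeriv`), and eliminating the Laplacian of f and Hess f(∇f) through the
trace of the equation and its contraction with ∇f, gives `pd_scal_of_einstein`: ½ d scal is
((m-1)/m) Ric(∇f) plus a multiple of df. Hence the tangential part of ∇scal is 2(m-1)/m times that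
of Ric(∇f).

On vectors tangent to Σ the df ⊗ df term vanishes and h = Hess f / |∇f| (`secondFF_eq`), so h = (λg
- Ric)/|∇f|. Its trace-free part is therefore minus the trace-free part of Ric restricted to TΣ,
divided by |∇f|.

What remains is linear algebra in an orthonormal frame: for a symmetric matrix R and a vector v ≠ 0,
`sum_sq_dTensor_frame` splits |D|² into the trace-free part of R on the complement of v and the part
of Rv orthogonal to v. Substituting the two geometric identities yields the theorem; the factor
m²/(m-1)² inverts the coefficient of Ric(∇f).

Geometry is done in a chart, with connection and curvature as matrices indexed by coordinate
directions, so that curvature identities become noncommutative polynomial identities. -/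

noncomputable section

namespace Coord

variable {n : ℕ}

/-! ### Partial derivatives of smooth functions on an open set -/

section Calculus

variable {U : Set (EuclideanSpace ℝ (Fin n))} {x : EuclideanSpace ℝ (Fin n)}
  {a b : EuclideanSpace ℝ (Fin n) → ℝ}

lemma differentiableAt_of_smoothOn (hU : IsOpen U) (hx : x ∈ U) (ha : ContDiffOn ℝ ∞ a U) :
    DifferentiableAt ℝ a x :=
  (ha.contDiffAt (hU.mem_nhds hx)).differentiableAt (by simp)

lemma smoothOn_pd (hU : IsOpen U) (ha : ContDiffOn ℝ ∞ a U) (i : Fin n) :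
    ContDiffOn ℝ ∞ (pd i a) U := by
  have h : ContDiffOn ℝ ∞ (fderiv ℝ a) U := ha.fderiv_of_isOpen hU (by simp)
  exact h.clm_apply contDiffOn_const

lemma pd_congr (hU : IsOpen U) (hx : x ∈ U) (h : ∀ y ∈ U, a y = b y) (i : Fin n) :
    pd i a x = pd i b x := by
  have : a =ᶠ[nhds x] b := Filter.eventuallyEq_of_mem (hU.mem_nhds hx) h
  simp only [pd, this.fderiv_eq]

@[simp] lemma pd_const (i : Fin n) (c : ℝ) : pd i (fun _ => c) x = 0 := by
  simp [pd]

lemma pd_add (ha : DifferentiableAt ℝ a x) (hb : DifferentiableAt ℝ b x) (i : Fin n) :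
    pd i (fun y => a y + b y) x = pd i a x + pd i b x := by
  simp [pd, fderiv_fun_add ha hb]

lemma pd_sub (ha : DifferentiableAt ℝ a x) (hb : DifferentiableAt ℝ b x) (i : Fin n) :
    pd i (fun y => a y - b y) x = pd i a x - pd i b x := by
  simp [pd, fderiv_fun_sub ha hb]

lemma pd_mul (ha : DifferentiableAt ℝ a x) (hb : DifferentiableAt ℝ b x) (i : Fin n) :
    pd i (fun y => a y * b y) x = pd i a x * b x + a x * pd i b x := by
  simp [pd, fderiv_fun_mul ha hb]; ring

lemma pd_const_mul (ha : DifferentiableAt ℝ a x) (c : ℝ) (i : Fin n) :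
    pd i (fun y => c * a y) x = c * pd i a x := by
  simp [pd, fderiv_const_mul ha c]

lemma pd_sum {ι : Type*} (s : Finset ι) {F : ι → EuclideanSpace ℝ (Fin n) → ℝ}
    (hF : ∀ j ∈ s, DifferentiableAt ℝ (F j) x) (i : Fin n) :
    pd i (fun y => ∑ j ∈ s, F j y) x = ∑ j ∈ s, pd i (F j) x := by
  simp [pd, fderiv_fun_sum hF]

lemma pd_comm (hU : IsOpen U) (hx : x ∈ U) (ha : ContDiffOn ℝ ∞ a U) (i j : Fin n) :
    pd i (pd j a) x = pd j (pd i a) x := by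
  have h : ContDiffOn ℝ ∞ (fderiv ℝ a) U := ha.fderiv_of_isOpen hU (by simp)
  have hd : DifferentiableAt ℝ (fderiv ℝ a) x :=
    (h.contDiffAt (hU.mem_nhds hx)).differentiableAt (by simp)
  have key : ∀ k l : Fin n, pd k (pd l a) x =
      fderiv ℝ (fderiv ℝ a) x (EuclideanSpace.single k 1) (EuclideanSpace.single l 1) := by
    intro k l
    change fderiv ℝ (fun y => fderiv ℝ a y (EuclideanSpace.single l 1)) x _ = _
    rw [fderiv_clm_apply hd (differentiableAt_const _)]
    simp
  rw [key, key]
  exact (ha.contDiffAt (hU.mem_nhds hx)).isSymmSndFDerivAt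
    (by simpa using WithTop.coe_le_coe.2 (le_top : (2 : ℕ∞) ≤ ⊤)) _ _

end Calculus

/-! ### Entrywise calculus of matrix-valued functions -/

section MatrixCalculus

variable {U : Set (EuclideanSpace ℝ (Fin n))} {x : EuclideanSpace ℝ (Fin n)}

/-- Entrywise smoothness of a matrix-valued function on `U`. -/
def MatSmoothOn (A : EuclideanSpace ℝ (Fin n) → Matrix (Fin n) (Fin n) ℝ)
    (U : Set (EuclideanSpace ℝ (Fin n))) : Prop :=
  ∀ a b, ContDiffOn ℝ ∞ (fun y => A y a b) U

/-- The entrywise partial derivative of a matrix-valued function. -/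
def matPd (i : Fin n) (A : EuclideanSpace ℝ (Fin n) → Matrix (Fin n) (Fin n) ℝ)
    (x : EuclideanSpace ℝ (Fin n)) : Matrix (Fin n) (Fin n) ℝ :=
  Matrix.of fun a b => pd i (fun y => A y a b) x

variable {A B : EuclideanSpace ℝ (Fin n) → Matrix (Fin n) (Fin n) ℝ}

lemma matPd_apply (i a b : Fin n) : matPd i A x a b = pd i (fun y => A y a b) x := rfl

lemma MatSmoothOn.mul (hA : MatSmoothOn A U) (hB : MatSmoothOn B U) :
    MatSmoothOn (fun y => A y * B y) U := fun a b => by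
  simp only [Matrix.mul_apply]
  exact ContDiffOn.sum fun s _ => (hA a s).mul (hB s b)

lemma MatSmoothOn.add (hA : MatSmoothOn A U) (hB : MatSmoothOn B U) :
    MatSmoothOn (fun y => A y + B y) U := fun a b => (hA a b).add (hB a b)

lemma MatSmoothOn.sub (hA : MatSmoothOn A U) (hB : MatSmoothOn B U) :
    MatSmoothOn (fun y => A y - B y) U := fun a b => (hA a b).sub (hB a b)

lemma MatSmoothOn.transpose (hA : MatSmoothOn A U) :
    MatSmoothOn (fun y => (A y).transpose) U := fun a b => hA b a

lemma MatSmoothOn.matPd (hU : IsOpen U) (hA : MatSmoothOn A U) (i : Fin n) :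
    MatSmoothOn (matPd i A) U := fun a b => smoothOn_pd hU (hA a b) i

lemma MatSmoothOn.det (hA : MatSmoothOn A U) : ContDiffOn ℝ ∞ (fun y => (A y).det) U := by
  simp only [Matrix.det_apply']
  exact ContDiffOn.sum fun s _ => contDiffOn_const.mul (contDiffOn_prod fun i _ => hA _ _)

/-- Cramer's rule: each entry of the inverse is a determinant of smooth entries divided by det A. -/
lemma MatSmoothOn.inv (hA : MatSmoothOn A U) (h : ∀ y ∈ U, (A y).det ≠ 0) :
    MatSmoothOn (fun y => (A y)⁻¹) U := by
  intro a b
  simp only [Matrix.inv_def, Matrix.smul_apply, Ring.inverse_eq_inv', Matrix.adjugate_apply,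
    smul_eq_mul]
  refine (hA.det.inv h).mul (MatSmoothOn.det fun c d => ?_)
  by_cases hc : c = b
  · subst hc; simpa using contDiffOn_const
  · simpa [Matrix.updateRow_ne hc] using hA c d

lemma matPd_congr (hU : IsOpen U) (hx : x ∈ U) (h : ∀ y ∈ U, A y = B y) (i : Fin n) :
    matPd i A x = matPd i B x := by
  ext a b
  exact pd_congr hU hx (fun y hy => by rw [h y hy]) i

lemma matPd_const (i : Fin n) (C : Matrix (Fin n) (Fin n) ℝ) : matPd i (fun _ => C) x = 0 := by
  ext a b; simp [matPd]

lemma matPd_transpose (i : Fin n) :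
    matPd i (fun y => (A y).transpose) x = (matPd i A x).transpose := rfl

lemma matPd_add (hU : IsOpen U) (hx : x ∈ U) (hA : MatSmoothOn A U) (hB : MatSmoothOn B U)
    (i : Fin n) : matPd i (fun y => A y + B y) x = matPd i A x + matPd i B x := by
  ext a b
  exact pd_add (differentiableAt_of_smoothOn hU hx (hA a b))
    (differentiableAt_of_smoothOn hU hx (hB a b)) i

lemma matPd_sub (hU : IsOpen U) (hx : x ∈ U) (hA : MatSmoothOn A U) (hB : MatSmoothOn B U)
    (i : Fin n) : matPd i (fun y => A y - B y) x = matPd i A x - matPd i B x := by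
  ext a b
  exact pd_sub (differentiableAt_of_smoothOn hU hx (hA a b))
    (differentiableAt_of_smoothOn hU hx (hB a b)) i

lemma matPd_mul (hU : IsOpen U) (hx : x ∈ U) (hA : MatSmoothOn A U) (hB : MatSmoothOn B U)
    (i : Fin n) :
    matPd i (fun y => A y * B y) x = matPd i A x * B x + A x * matPd i B x := by
  ext a b
  have h1 : ∀ s, DifferentiableAt ℝ (fun y => A y a s) x := fun s =>
    differentiableAt_of_smoothOn hU hx (hA a s)
  have h2 : ∀ s, DifferentiableAt ℝ (fun y => B y s b) x := fun s =>
    differentiableAt_of_smoothOn hU hx (hB s b)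
  simp only [matPd_apply, Matrix.mul_apply, Matrix.add_apply]
  rw [pd_sum _ fun s _ => (h1 s).fun_mul (h2 s), ← Finset.sum_add_distrib]
  exact Finset.sum_congr rfl fun s _ => pd_mul (h1 s) (h2 s) i

lemma matPd_comm (hU : IsOpen U) (hx : x ∈ U) (hA : MatSmoothOn A U) (i j : Fin n) :
    matPd i (matPd j A) x = matPd j (matPd i A) x := by
  ext a b
  exact pd_comm hU hx (hA a b) i j

end MatrixCalculus

end Coord
-- From the manifold to a chart: smoothness and positivity of the metric components
section Chart

variable {n : ℕ} {M : Type*} [TopologicalSpace M]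
  [ChartedSpace (EuclideanSpace ℝ (Fin n)) M] [IsManifold (𝓡 n) ∞ M]
  {φ : OpenPartialHomeomorph M (EuclideanSpace ℝ (Fin n))}

/-- The coordinate fields are the tangent map of φ⁻¹ composed with constant fields; pairing two of
them under g then gives smooth metric components. -/
lemma contMDiffOn_coordinateField (hφ : φ ∈ IsManifold.maximalAtlas (𝓡 n) ∞ M)
    (v : EuclideanSpace ℝ (Fin n)) :
    ContMDiffOn (𝓡 n) ((𝓡 n).prod 𝓘(ℝ, EuclideanSpace ℝ (Fin n))) ∞
      (fun y => (Bundle.TotalSpace.mk' (EuclideanSpace ℝ (Fin n))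
        (E := fun q : M => TangentSpace (𝓡 n) q) (φ.symm y)
        (mfderiv (𝓡 n) (𝓡 n) φ.symm y v))) φ.target := by
  have h1 := (contMDiffOn_symm_of_mem_maximalAtlas hφ).contMDiffOn_tangentMapWithin
    (m := ∞) (by simp) φ.open_target.uniqueMDiffOn
  have h2 : ContMDiffOn (𝓡 n) ((𝓡 n).prod 𝓘(ℝ, EuclideanSpace ℝ (Fin n))) ∞
      (fun y => (Bundle.TotalSpace.mk' (EuclideanSpace ℝ (Fin n))
        (E := fun q : EuclideanSpace ℝ (Fin n) => TangentSpace (𝓡 n) q) y v)) φ.target := by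
    exact (contMDiff_vectorSpace_iff_contDiff.2 contDiff_const).contMDiffOn
  refine (h1.comp h2 fun y hy => hy).congr fun y hy => ?_
  simp only [Function.comp, tangentMapWithin]
  rw [mfderivWithin_of_isOpen φ.open_target hy]

lemma matSmoothOn_metricInChart
    (g : Bundle.ContMDiffRiemannianMetric (𝓡 n) ∞ (EuclideanSpace ℝ (Fin n))
      (fun q : M => TangentSpace (𝓡 n) q))
    (hφ : φ ∈ IsManifold.maximalAtlas (𝓡 n) ∞ M) :
    Coord.MatSmoothOn (metricInChart g φ) φ.target := by
  intro i j
  have h0 := g.contMDiff.comp_contMDiffOn (contMDiffOn_symm_of_mem_maximalAtlas hφ)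
  have h1 := contMDiffOn_coordinateField hφ (EuclideanSpace.single i (1 : ℝ))
  have h2 := contMDiffOn_coordinateField hφ (EuclideanSpace.single j (1 : ℝ))
  have h3 := ContMDiffOn.clm_bundle_apply₂ (F₃ := ℝ) (E₃ := Bundle.Trivial M ℝ) h0 h1 h2
  rw [← contMDiffOn_iff_contDiffOn]
  intro y hy
  have h4 := h3 y hy
  exact (Bundle.contMDiffWithinAt_totalSpace.1 h4).2

lemma metricInChart_symm
    (g : Bundle.ContMDiffRiemannianMetric (𝓡 n) ∞ (EuclideanSpace ℝ (Fin n))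
      (fun q : M => TangentSpace (𝓡 n) q)) (y : EuclideanSpace ℝ (Fin n)) (i j : Fin n) :
    metricInChart g φ y i j = metricInChart g φ y j i := g.symm _ _ _

/-- The differential of φ⁻¹ is injective, since dφ is a left inverse by the chain rule, so
positivity of g pulls back. -/
lemma metricInChart_posDef
    (g : Bundle.ContMDiffRiemannianMetric (𝓡 n) ∞ (EuclideanSpace ℝ (Fin n))
      (fun q : M => TangentSpace (𝓡 n) q))
    (hφ : φ ∈ IsManifold.maximalAtlas (𝓡 n) ∞ M) {y : EuclideanSpace ℝ (Fin n)}
    (hy : y ∈ φ.target) : (metricInChart g φ y).PosDef := by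
  set L := mfderiv (𝓡 n) (𝓡 n) φ.symm y with hL
  have hinj : Function.Injective L := by
    have h1 : MDifferentiableAt (𝓡 n) (𝓡 n) φ (φ.symm y) :=
      (contMDiffAt_of_mem_maximalAtlas hφ (φ.map_target hy)).mdifferentiableAt (by simp)
    have h2 : MDifferentiableAt (𝓡 n) (𝓡 n) φ.symm y :=
      (contMDiffAt_symm_of_mem_maximalAtlas hφ hy).mdifferentiableAt (by simp)
    have h3 := mfderiv_comp y h1 h2
    have h4 : mfderiv (𝓡 n) (𝓡 n) (φ ∘ φ.symm) y =
        ContinuousLinearMap.id ℝ (TangentSpace (𝓡 n) y) := by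
      rw [← mfderiv_id]
      exact Filter.EventuallyEq.mfderiv_eq (Filter.eventuallyEq_of_mem
        (φ.open_target.mem_nhds hy) fun z hz => φ.right_inv hz)
    rw [h4] at h3
    intro v w hvw
    have e1 := congrArg (fun T => T v) h3
    have e2 := congrArg (fun T => T w) h3
    have : mfderiv (𝓡 n) (𝓡 n) φ (φ.symm y) (L v) = mfderiv (𝓡 n) (𝓡 n) φ (φ.symm y) (L w) := by
      rw [hvw]
    exact e1.trans (this.trans e2.symm)
  refine Matrix.PosDef.of_dotProduct_mulVec_pos ?_ fun c hc => ?_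
  · ext i j
    simpa using metricInChart_symm g y j i
  · set w : EuclideanSpace ℝ (Fin n) := ∑ i, c i • EuclideanSpace.single i (1 : ℝ) with hw
    have hwc : ∀ i, w i = c i := by
      intro i
      simp [hw, Pi.single_apply]
    have hw0 : w ≠ 0 := by
      intro h
      exact hc (funext fun i => by rw [← hwc i, h]; rfl)
    have hLw : L w ≠ 0 := fun h => hw0 (hinj (h.trans (map_zero L).symm))
    have := g.pos _ _ hLw
    refine this.trans_eq ?_
    have e : L w = ∑ i, c i • L (EuclideanSpace.single i (1 : ℝ)) := by
      rw [hw]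
      erw [map_sum]
      exact Finset.sum_congr rfl fun i _ => map_smul L _ _
    rw [e]
    simp only [map_sum, map_smul, dotProduct, Matrix.mulVec, star_trivial, metricInChart,
      Matrix.of_apply, sum_apply, smul_apply, smul_eq_mul,
      Finset.mul_sum]
    rw [Finset.sum_comm]
    refine Finset.sum_congr rfl fun i _ => Finset.sum_congr rfl fun j _ => ?_
    ring_nf
    rfl

omit [IsManifold (𝓡 n) ∞ M] in
lemma exists_pd_ne_zero {f : M → ℝ} (hf : ContMDiff (𝓡 n) 𝓘(ℝ) ∞ f)
    (hφ : φ ∈ IsManifold.maximalAtlas (𝓡 n) ∞ M) {p : M} (hp : p ∈ φ.source)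
    (h : mfderiv (𝓡 n) 𝓘(ℝ) f p ≠ 0) : ∃ i, Coord.pd i (f ∘ φ.symm) (φ p) ≠ 0 := by
  by_contra! hc
  apply h
  have h0 : fderiv ℝ (f ∘ φ.symm) (φ p) = 0 := by
    ext v
    have hv : v = ∑ i, v i • EuclideanSpace.single i (1 : ℝ) := by
      ext j; simp [Pi.single_apply]
    rw [hv, map_sum]
    refine Finset.sum_eq_zero fun i _ => ?_
    rw [map_smul]
    have := hc i
    rw [Coord.pd] at this
    rw [this, smul_zero]
  have hs : φ p ∈ φ.target := φ.map_source hp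
  have h1 : MDifferentiableAt (𝓡 n) (𝓡 n) φ p :=
    (contMDiffAt_of_mem_maximalAtlas hφ hp).mdifferentiableAt (by simp)
  have h2 : MDifferentiableAt (𝓡 n) 𝓘(ℝ) (f ∘ φ.symm) (φ p) :=
    (hf.contMDiffAt.comp _ (contMDiffAt_symm_of_mem_maximalAtlas hφ hs)).mdifferentiableAt
      (by simp)
  have h3 := mfderiv_comp p h2 h1
  have h4 : mfderiv (𝓡 n) 𝓘(ℝ) ((f ∘ φ.symm) ∘ φ) p = mfderiv (𝓡 n) 𝓘(ℝ) f p :=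
    Filter.EventuallyEq.mfderiv_eq (Filter.eventuallyEq_of_mem
      (φ.open_source.mem_nhds hp) fun z hz => congrArg f (φ.left_inv hz))
  rw [← h4, h3, mfderiv_eq_fderiv, h0]
  ext v
  rfl

omit [IsManifold (𝓡 n) ∞ M] in
lemma contDiffOn_comp_chart_symm {f : M → ℝ} (hf : ContMDiff (𝓡 n) 𝓘(ℝ) ∞ f)
    (hφ : φ ∈ IsManifold.maximalAtlas (𝓡 n) ∞ M) : ContDiffOn ℝ ∞ (f ∘ φ.symm) φ.target := by
  rw [← contMDiffOn_iff_contDiffOn]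
  exact hf.comp_contMDiffOn (contMDiffOn_symm_of_mem_maximalAtlas hφ)

end Chart
-- Connection and curvature matrices, curvature symmetries, second Bianchi identity
namespace Coord

variable {n : ℕ}

/-- A smooth symmetric nondegenerate metric on the open set `U`. -/
structure IsMetricOn (G : EuclideanSpace ℝ (Fin n) → Matrix (Fin n) (Fin n) ℝ)
    (U : Set (EuclideanSpace ℝ (Fin n))) : Prop where
  isOpen : IsOpen U
  smooth : MatSmoothOn G U
  symm : ∀ y i j, G y i j = G y j i
  det_ne_zero : ∀ y ∈ U, (G y).det ≠ 0

/-- The matrix `(Γ_i)^l_k` of the connection in the direction `∂_i`. -/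
def connMat (G : EuclideanSpace ℝ (Fin n) → Matrix (Fin n) (Fin n) ℝ) (i : Fin n)
    (y : EuclideanSpace ℝ (Fin n)) : Matrix (Fin n) (Fin n) ℝ :=
  Matrix.of fun l k => christoffel G l i k y

/-- The matrix `(R_{ij})^l_k` of the curvature endomorphism `R(∂_i, ∂_j)`. -/
def curvMat (G : EuclideanSpace ℝ (Fin n) → Matrix (Fin n) (Fin n) ℝ) (i j : Fin n)
    (y : EuclideanSpace ℝ (Fin n)) : Matrix (Fin n) (Fin n) ℝ :=
  Matrix.of fun l k => riemann G i j k l y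

/-- The curvature with its endomorphism indices raised, `(R_{ij})^{lk}`. -/
def curvUp (G : EuclideanSpace ℝ (Fin n) → Matrix (Fin n) (Fin n) ℝ) (i j : Fin n)
    (y : EuclideanSpace ℝ (Fin n)) : Matrix (Fin n) (Fin n) ℝ :=
  curvMat G i j y * (G y)⁻¹

/-- The Ricci tensor with one index raised, `Ric_k^i`, at position `i k`. -/
def ricciMixed (G : EuclideanSpace ℝ (Fin n) → Matrix (Fin n) (Fin n) ℝ)
    (i k : Fin n) (y : EuclideanSpace ℝ (Fin n)) : ℝ :=
  ∑ j, curvUp G j k y j i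

namespace IsMetricOn

variable {G : EuclideanSpace ℝ (Fin n) → Matrix (Fin n) (Fin n) ℝ}
  {U : Set (EuclideanSpace ℝ (Fin n))} {x : EuclideanSpace ℝ (Fin n)}

lemma transpose_eq (h : IsMetricOn G U) (y : EuclideanSpace ℝ (Fin n)) :
    (G y).transpose = G y := by
  ext i j; exact h.symm y j i

lemma inv_transpose (h : IsMetricOn G U) (y : EuclideanSpace ℝ (Fin n)) :
    (G y)⁻¹.transpose = (G y)⁻¹ := by
  rw [Matrix.transpose_nonsing_inv, h.transpose_eq]

lemma inv_symm (h : IsMetricOn G U) (y : EuclideanSpace ℝ (Fin n)) (i j : Fin n) :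
    (G y)⁻¹ i j = (G y)⁻¹ j i := congrFun (congrFun (h.inv_transpose y) j) i

lemma mul_inv (h : IsMetricOn G U) (hx : x ∈ U) : G x * (G x)⁻¹ = 1 :=
  Matrix.mul_nonsing_inv _ (h.det_ne_zero x hx).isUnit

lemma inv_mul (h : IsMetricOn G U) (hx : x ∈ U) : (G x)⁻¹ * G x = 1 :=
  Matrix.nonsing_inv_mul _ (h.det_ne_zero x hx).isUnit

lemma smooth_inv (h : IsMetricOn G U) : MatSmoothOn (fun y => (G y)⁻¹) U :=
  h.smooth.inv h.det_ne_zero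

lemma smooth_christoffel (h : IsMetricOn G U) (k i j : Fin n) :
    ContDiffOn ℝ ∞ (christoffel G k i j) U := by
  have hG : ∀ a b c, ContDiffOn ℝ ∞ (pd a fun y => G y b c) U := fun a b c =>
    smoothOn_pd h.isOpen (h.smooth b c) a
  unfold christoffel
  exact contDiffOn_const.mul (ContDiffOn.sum fun l _ => (h.smooth_inv k l).mul
    (((hG _ _ _).add (hG _ _ _)).sub (hG _ _ _)))

lemma smooth_conn (h : IsMetricOn G U) (i : Fin n) : MatSmoothOn (connMat G i) U :=
  fun l k => h.smooth_christoffel l i k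

lemma christoffel_symm (h : IsMetricOn G U) (k i j : Fin n) (y : EuclideanSpace ℝ (Fin n)) :
    christoffel G k i j y = christoffel G k j i y := by
  unfold christoffel
  congr 1
  refine Finset.sum_congr rfl fun l _ => ?_
  have : (fun y => G y i j) = fun y => G y j i := funext fun y => h.symm y i j
  rw [this]
  ring

/-- Metric compatibility of the Levi-Civita connection. Lowering the upper index of Γ_i gives the
Koszul matrix C, and in C + Cᵀ the last two derivative terms cancel. -/
lemma matPd_metric (h : IsMetricOn G U) (hx : x ∈ U) (i : Fin n) :
    matPd i G x = (connMat G i x).transpose * G x + G x * connMat G i x := by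
  set C : Matrix (Fin n) (Fin n) ℝ := Matrix.of fun s k => (1 / 2 : ℝ) *
    (pd i (fun y => G y k s) x + pd k (fun y => G y i s) x - pd s (fun y => G y i k) x) with hC
  have h1 : connMat G i x = (G x)⁻¹ * C := by
    ext l k
    simp only [connMat, christoffel, Matrix.of_apply, Matrix.mul_apply, hC, Finset.mul_sum]
    exact Finset.sum_congr rfl fun s _ => by ring
  have h2 : G x * connMat G i x = C := by
    rw [h1, ← Matrix.mul_assoc, h.mul_inv hx, Matrix.one_mul]
  have h3 : (connMat G i x).transpose * G x = C.transpose := by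
    rw [← h2, Matrix.transpose_mul, h.transpose_eq]
  rw [h2, h3]
  ext a b
  have : (fun y => G y b a) = fun y => G y a b := funext fun y => h.symm y b a
  simp only [matPd_apply, hC, Matrix.add_apply, Matrix.transpose_apply, Matrix.of_apply, this]
  ring

/-- Obtained by differentiating G⁻¹G = 1: the inverse metric is parallel as well. -/
lemma matPd_inv (h : IsMetricOn G U) (hx : x ∈ U) (i : Fin n) :
    matPd i (fun y => (G y)⁻¹) x =
      -(connMat G i x * (G x)⁻¹) - (G x)⁻¹ * (connMat G i x).transpose := by
  have h1 := matPd_congr (A := fun y => (G y)⁻¹ * G y) (B := fun _ => 1) h.isOpen hx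
    (fun y hy => h.inv_mul hy) i
  rw [matPd_mul h.isOpen hx h.smooth_inv h.smooth, matPd_const, h.matPd_metric hx] at h1
  have h2 := congrArg (· * (G x)⁻¹) h1
  simp only [Matrix.add_mul, Matrix.mul_add, Matrix.zero_mul, Matrix.mul_assoc, h.mul_inv hx,
    Matrix.mul_one] at h2
  rw [← Matrix.mul_assoc (G x)⁻¹ (G x), h.inv_mul hx, Matrix.one_mul] at h2
  rw [← sub_eq_zero, ← h2]
  abel

/-- The structure equation R_ij = ∂_iΓ_j - ∂_jΓ_i + [Γ_i, Γ_j], the source of all later curvature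
identities. -/
lemma curvMat_eq (i j : Fin n) (y : EuclideanSpace ℝ (Fin n)) :
    curvMat G i j y = matPd i (connMat G j) y - matPd j (connMat G i) y
      + connMat G i y * connMat G j y - connMat G j y * connMat G i y := by
  ext l k
  simp only [curvMat, riemann, connMat, matPd, Matrix.of_apply, Matrix.add_apply,
    Matrix.sub_apply, Matrix.mul_apply, Finset.sum_sub_distrib]
  ring

lemma curvMat_antisymm (i j : Fin n) (y : EuclideanSpace ℝ (Fin n)) :
    curvMat G i j y = -curvMat G j i y := by
  rw [curvMat_eq, curvMat_eq]; abel

lemma smooth_curvMat (h : IsMetricOn G U) (i j : Fin n) : MatSmoothOn (curvMat G i j) U := by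
  have : curvMat G i j = fun y => matPd i (connMat G j) y - matPd j (connMat G i) y
      + connMat G i y * connMat G j y - connMat G j y * connMat G i y :=
    funext fun y => curvMat_eq i j y
  rw [this]
  exact ((((h.smooth_conn j).matPd h.isOpen i).sub ((h.smooth_conn i).matPd h.isOpen j)).add
    ((h.smooth_conn i).mul (h.smooth_conn j))).sub ((h.smooth_conn j).mul (h.smooth_conn i))

lemma smooth_curvUp (h : IsMetricOn G U) (i j : Fin n) : MatSmoothOn (curvUp G i j) U :=
  (h.smooth_curvMat i j).mul h.smooth_inv

lemma matPd_matPd_metric (h : IsMetricOn G U) (hx : x ∈ U) (i j : Fin n) :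
    matPd i (matPd j G) x = (matPd i (connMat G j) x).transpose * G x
      + (connMat G j x).transpose * ((connMat G i x).transpose * G x + G x * connMat G i x)
      + (((connMat G i x).transpose * G x + G x * connMat G i x) * connMat G j x
      + G x * matPd i (connMat G j) x) := by
  rw [matPd_congr h.isOpen hx (fun y hy => h.matPd_metric hy j),
    matPd_add h.isOpen hx ((h.smooth_conn j).transpose.mul h.smooth)
      (h.smooth.mul (h.smooth_conn j)),
    matPd_mul h.isOpen hx (h.smooth_conn j).transpose h.smooth,
    matPd_mul h.isOpen hx h.smooth (h.smooth_conn j), matPd_transpose, h.matPd_metric hx]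

/-- Expanding ∂_i∂_jG by metric compatibility, the difference ∂_i∂_jG - ∂_j∂_iG = 0 is exactly RᵀG +
GR. -/
lemma curvMat_skew (h : IsMetricOn G U) (hx : x ∈ U) (i j : Fin n) :
    (curvMat G i j x).transpose * G x = -(G x * curvMat G i j x) := by
  have h1 := matPd_comm h.isOpen hx h.smooth i j
  rw [h.matPd_matPd_metric hx, h.matPd_matPd_metric hx, ← sub_eq_zero] at h1
  rw [← sub_eq_zero, ← h1, curvMat_eq]
  simp only [Matrix.transpose_add, Matrix.transpose_sub, Matrix.transpose_mul]
  noncomm_ring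

/-- With both endomorphism indices up, skewness with respect to g becomes plain antisymmetry, which
is convenient for contractions. -/
lemma curvUp_transpose (h : IsMetricOn G U) (hx : x ∈ U) (i j : Fin n) :
    (curvUp G i j x).transpose = -curvUp G i j x := by
  have h1 := congrArg (fun A => (G x)⁻¹ * A * (G x)⁻¹) (h.curvMat_skew hx i j)
  simp only [Matrix.mul_assoc, h.mul_inv hx, Matrix.mul_one, Matrix.neg_mul, Matrix.mul_neg] at h1
  rw [← Matrix.mul_assoc (G x)⁻¹ (G x), h.inv_mul hx, Matrix.one_mul] at h1
  rw [curvUp, Matrix.transpose_mul, h.inv_transpose, h1]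

/-- Only the endomorphism indices are differentiated covariantly: the Christoffel terms on the form
indices would cancel in the cyclic sum, as Γ is symmetric. Second derivatives of Γ cancel because
partials commute, and the rest is the Jacobi identity and its companions. -/
lemma bianchi (h : IsMetricOn G U) (hx : x ∈ U) (i j k : Fin n) :
    (matPd i (curvMat G j k) x + connMat G i x * curvMat G j k x
        - curvMat G j k x * connMat G i x)
      + (matPd j (curvMat G k i) x + connMat G j x * curvMat G k i x
        - curvMat G k i x * connMat G j x)
      + (matPd k (curvMat G i j) x + connMat G k x * curvMat G i j x
        - curvMat G i j x * connMat G k x) = 0 := by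
  have hd : ∀ a b c, matPd a (curvMat G b c) x =
      matPd a (matPd b (connMat G c)) x - matPd a (matPd c (connMat G b)) x
        + (matPd a (connMat G b) x * connMat G c x + connMat G b x * matPd a (connMat G c) x)
        - (matPd a (connMat G c) x * connMat G b x + connMat G c x * matPd a (connMat G b) x) := by
    intro a b c
    have s1 := fun a b => (h.smooth_conn b).matPd h.isOpen a
    have s2 := fun a b => (h.smooth_conn a).mul (h.smooth_conn b)
    rw [matPd_congr h.isOpen hx (fun y _ => curvMat_eq b c y),
      matPd_sub h.isOpen hx (((s1 b c).sub (s1 c b)).add (s2 b c)) (s2 c b),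
      matPd_add h.isOpen hx ((s1 b c).sub (s1 c b)) (s2 b c),
      matPd_sub h.isOpen hx (s1 b c) (s1 c b),
      matPd_mul h.isOpen hx (h.smooth_conn b) (h.smooth_conn c),
      matPd_mul h.isOpen hx (h.smooth_conn c) (h.smooth_conn b)]
  rw [hd, hd, hd, matPd_comm h.isOpen hx (h.smooth_conn i) k j,
    matPd_comm h.isOpen hx (h.smooth_conn j) k i, matPd_comm h.isOpen hx (h.smooth_conn k) j i,
    curvMat_eq, curvMat_eq, curvMat_eq]
  noncomm_ring

lemma covDeriv_curvUp (h : IsMetricOn G U) (hx : x ∈ U) (i j k : Fin n) :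
    matPd i (curvUp G j k) x + connMat G i x * curvUp G j k x
        + curvUp G j k x * (connMat G i x).transpose =
      (matPd i (curvMat G j k) x + connMat G i x * curvMat G j k x
        - curvMat G j k x * connMat G i x) * (G x)⁻¹ := by
  rw [show matPd i (curvUp G j k) x = _ from
    matPd_mul h.isOpen hx (h.smooth_curvMat j k) h.smooth_inv i, h.matPd_inv hx, curvUp]
  noncomm_ring

lemma bianchi_curvUp (h : IsMetricOn G U) (hx : x ∈ U) (i j k : Fin n) :
    (matPd i (curvUp G j k) x + connMat G i x * curvUp G j k x
        + curvUp G j k x * (connMat G i x).transpose)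
      + (matPd j (curvUp G k i) x + connMat G j x * curvUp G k i x
        + curvUp G k i x * (connMat G j x).transpose)
      + (matPd k (curvUp G i j) x + connMat G k x * curvUp G i j x
        + curvUp G i j x * (connMat G k x).transpose) = 0 := by
  rw [h.covDeriv_curvUp hx, h.covDeriv_curvUp hx, h.covDeriv_curvUp hx, ← Matrix.add_mul,
    ← Matrix.add_mul, h.bianchi hx, Matrix.zero_mul]

end IsMetricOn

end Coord
-- Divergences: contracted Bianchi identity and Bochner commutation
namespace Coord

variable {n : ℕ}

/-- The divergence `∇_i A_k^i` of a `(1,1)`-tensor with components `A i k = A_k^i`. -/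
def divMixed (G : EuclideanSpace ℝ (Fin n) → Matrix (Fin n) (Fin n) ℝ)
    (A : Fin n → Fin n → EuclideanSpace ℝ (Fin n) → ℝ) (k : Fin n)
    (x : EuclideanSpace ℝ (Fin n)) : ℝ :=
  ∑ i, pd i (A i k) x + ∑ i, ∑ s, christoffel G i i s x * A s k x
    - ∑ i, ∑ s, christoffel G i k s x * A s i x

/-- The components `∇_k V^i`, at position `i k`, of the covariant derivative of `V`. -/
def covDerivComp (G : EuclideanSpace ℝ (Fin n) → Matrix (Fin n) (Fin n) ℝ)
    (V : EuclideanSpace ℝ (Fin n) → Fin n → ℝ) (i k : Fin n)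
    (x : EuclideanSpace ℝ (Fin n)) : ℝ :=
  pd k (fun y => V y i) x + ∑ s, christoffel G i k s x * V x s

namespace IsMetricOn

variable {G : EuclideanSpace ℝ (Fin n) → Matrix (Fin n) (Fin n) ℝ}
  {U : Set (EuclideanSpace ℝ (Fin n))} {x : EuclideanSpace ℝ (Fin n)}

lemma curvUp_swap_up (h : IsMetricOn G U) (hx : x ∈ U) (i j a b : Fin n) :
    curvUp G i j x a b = -curvUp G i j x b a :=
  congrFun (congrFun (h.curvUp_transpose hx i j) b) a

lemma curvUp_swap_down (i j a b : Fin n) :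
    curvUp G i j x a b = -curvUp G j i x a b := by
  rw [curvUp, curvMat_antisymm, Matrix.neg_mul, Matrix.neg_apply, curvUp]

lemma curvUp_swap (h : IsMetricOn G U) (hx : x ∈ U) (i j a b : Fin n) :
    curvUp G i j x a b = curvUp G j i x b a := by
  rw [h.curvUp_swap_up hx, curvUp_swap_down, neg_neg]

lemma ricciMixed_eq (i k : Fin n) :
    ricciMixed G i k x = ∑ s, ricciComp G k s x * (G x)⁻¹ s i := by
  simp only [ricciMixed, curvUp, Matrix.mul_apply, ricciComp, Finset.sum_mul, curvMat,
    Matrix.of_apply]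
  rw [Finset.sum_comm]

lemma scal_eq (h : IsMetricOn G U) : scal G x = ∑ i, ricciMixed G i i x := by
  simp only [scal, ricciMixed_eq]
  exact Finset.sum_congr rfl fun i _ => Finset.sum_congr rfl fun j _ => by
    rw [h.inv_symm x i j, mul_comm]

/-- One of the three traces in the contracted Bianchi identity. It lacks the Christoffel term on the
index k; that term is supplied by the trace of the third cyclic summand. -/
lemma sum_covDeriv_curvUp (h : IsMetricOn G U) (hx : x ∈ U) (k : Fin n) :
    ∑ i, ∑ j, (matPd i (curvUp G j k) x + connMat G i x * curvUp G j k x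
        + curvUp G j k x * (connMat G i x).transpose) i j
      = -(∑ i, pd i (ricciMixed G i k) x
        + ∑ i, ∑ s, christoffel G i i s x * ricciMixed G s k x) := by
  have hd : ∀ i j a b, DifferentiableAt ℝ (fun y => curvUp G i j y a b) x := fun i j a b =>
    differentiableAt_of_smoothOn h.isOpen hx (h.smooth_curvUp i j a b)
  have t1 : ∑ i, ∑ j, matPd i (curvUp G j k) x i j = -∑ i, pd i (ricciMixed G i k) x := by
    rw [← Finset.sum_neg_distrib]
    refine Finset.sum_congr rfl fun i _ => ?_
    have e : pd i (ricciMixed G i k) x = ∑ j, pd i (fun y => curvUp G j k y j i) x :=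
      pd_sum Finset.univ (fun j _ => hd j k j i) i
    rw [e, ← Finset.sum_neg_distrib]
    refine Finset.sum_congr rfl fun j _ => ?_
    have e1 : pd i (fun y => curvUp G j k y i j) x
        = pd i (fun y => (-1) * curvUp G j k y j i) x :=
      pd_congr h.isOpen hx (fun y hy => by rw [h.curvUp_swap_up hy, neg_one_mul]) i
    rw [matPd_apply, e1, pd_const_mul (hd j k j i), neg_one_mul]
  have t2 : ∑ i, ∑ j, (connMat G i x * curvUp G j k x) i j
      = -∑ i, ∑ s, christoffel G i i s x * ricciMixed G s k x := by
    simp only [Matrix.mul_apply, connMat, Matrix.of_apply, ricciMixed, ← Finset.sum_neg_distrib,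
      Finset.mul_sum]
    refine Finset.sum_congr rfl fun i _ => ?_
    rw [Finset.sum_comm]
    refine Finset.sum_congr rfl fun s _ => Finset.sum_congr rfl fun j _ => ?_
    rw [h.curvUp_swap_up hx, mul_neg]
  -- For fixed j, an expression antisymmetric in (i, s) is contracted with Γ^j_{is}, which is
  -- symmetric.
  have t3 : ∑ i, ∑ j, (curvUp G j k x * (connMat G i x).transpose) i j = 0 := by
    simp only [Matrix.mul_apply, connMat, Matrix.of_apply, Matrix.transpose_apply]
    rw [Finset.sum_comm]
    refine Finset.sum_eq_zero fun j _ => ?_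
    have : ∑ i, ∑ s, curvUp G j k x i s * christoffel G j i s x
        = -∑ i, ∑ s, curvUp G j k x i s * christoffel G j i s x := by
      conv_lhs => rw [Finset.sum_comm]
      simp only [← Finset.sum_neg_distrib]
      refine Finset.sum_congr rfl fun i _ => Finset.sum_congr rfl fun s _ => ?_
      rw [h.curvUp_swap_up hx, h.christoffel_symm, neg_mul]
    linarith
  simp only [Matrix.add_apply, Finset.sum_add_distrib]
  rw [t1, t2, t3]
  ring

/-- The contracted second Bianchi identity `∇_i Ric_k^i = ½ ∂_k scal`. -/
lemma divMixed_ricci (h : IsMetricOn G U) (hx : x ∈ U) (k : Fin n) :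
    divMixed G (ricciMixed G) k x = 1 / 2 * pd k (scal G) x := by
  have hd : ∀ i j a b, DifferentiableAt ℝ (fun y => curvUp G i j y a b) x := fun i j a b =>
    differentiableAt_of_smoothOn h.isOpen hx (h.smooth_curvUp i j a b)
  have hB : ∑ i, ∑ j, ((matPd i (curvUp G j k) x + connMat G i x * curvUp G j k x
        + curvUp G j k x * (connMat G i x).transpose)
      + (matPd j (curvUp G k i) x + connMat G j x * curvUp G k i x
        + curvUp G k i x * (connMat G j x).transpose)
      + (matPd k (curvUp G i j) x + connMat G k x * curvUp G i j x
        + curvUp G i j x * (connMat G k x).transpose)) i j = 0 :=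
    Finset.sum_eq_zero fun i _ => Finset.sum_eq_zero fun j _ => by
      rw [h.bianchi_curvUp hx, Matrix.zero_apply]
  simp only [Matrix.add_apply _ (_ + (_ : Matrix (Fin n) (Fin n) ℝ)),
    Finset.sum_add_distrib (f := fun j => (_ : ℝ))] at hB
  -- Two of the three cyclic summands have the same trace; this produces the factor ½ in the
  -- contracted identity.
  have hs : ∑ i, ∑ j, (matPd j (curvUp G k i) x + connMat G j x * curvUp G k i x
        + curvUp G k i x * (connMat G j x).transpose) i j
      = ∑ i, ∑ j, (matPd i (curvUp G j k) x + connMat G i x * curvUp G j k x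
        + curvUp G j k x * (connMat G i x).transpose) i j := by
    rw [Finset.sum_comm]
    refine Finset.sum_congr rfl fun j _ => Finset.sum_congr rfl fun i _ => ?_
    simp only [Matrix.add_apply, matPd_apply, Matrix.mul_apply, Matrix.transpose_apply]
    have e1 : pd j (fun y => curvUp G k i y i j) x = pd j (fun y => curvUp G i k y j i) x :=
      pd_congr h.isOpen hx (fun y hy => h.curvUp_swap hy _ _ _ _) j
    rw [e1, add_assoc, add_assoc, add_comm (∑ s, connMat G j x i s * _)]
    congr 2
    · refine Finset.sum_congr rfl fun s _ => ?_
      rw [h.curvUp_swap hx, mul_comm]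
    · refine Finset.sum_congr rfl fun s _ => ?_
      rw [h.curvUp_swap hx, mul_comm]
  have t1 : ∑ i, ∑ j, matPd k (curvUp G i j) x i j = pd k (scal G) x := by
    have e : scal G = fun y => ∑ i, ∑ j, curvUp G i j y i j := by
      funext y
      rw [h.scal_eq, Finset.sum_comm]
      rfl
    rw [e, pd_sum _ fun i _ => DifferentiableAt.fun_sum fun j _ => hd i j i j]
    refine Finset.sum_congr rfl fun i _ => ?_
    rw [pd_sum _ fun j _ => hd i j i j]
    rfl
  have t2 : ∑ i, ∑ j, (connMat G k x * curvUp G i j x) i j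
      = ∑ i, ∑ s, christoffel G i k s x * ricciMixed G s i x := by
    simp only [Matrix.mul_apply, connMat, Matrix.of_apply, ricciMixed, Finset.mul_sum]
    refine Finset.sum_congr rfl fun i _ => ?_
    rw [Finset.sum_comm]
    refine Finset.sum_congr rfl fun s _ => Finset.sum_congr rfl fun j _ => ?_
    rw [h.curvUp_swap hx]
  have t3 : ∑ i, ∑ j, (curvUp G i j x * (connMat G k x).transpose) i j
      = ∑ i, ∑ s, christoffel G i k s x * ricciMixed G s i x := by
    simp only [Matrix.mul_apply, connMat, Matrix.of_apply, ricciMixed, Finset.mul_sum,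
      Matrix.transpose_apply]
    rw [Finset.sum_comm]
    refine Finset.sum_congr rfl fun i _ => ?_
    rw [Finset.sum_comm]
    refine Finset.sum_congr rfl fun s _ => Finset.sum_congr rfl fun j _ => ?_
    rw [mul_comm]
  have t : ∑ i, ∑ j, (matPd k (curvUp G i j) x + connMat G k x * curvUp G i j x
        + curvUp G i j x * (connMat G k x).transpose) i j
      = pd k (scal G) x + ∑ i, ∑ s, christoffel G i k s x * ricciMixed G s i x
        + ∑ i, ∑ s, christoffel G i k s x * ricciMixed G s i x := by
    simp only [Matrix.add_apply, Finset.sum_add_distrib]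
    rw [t1, t2, t3]
  rw [hs, t, h.sum_covDeriv_curvUp hx] at hB
  rw [divMixed]
  linarith

/-- The commutator of covariant derivatives is the curvature, for the columns of `W`. -/
lemma ricci_identity_mat (h : IsMetricOn G U) (hx : x ∈ U)
    {W : EuclideanSpace ℝ (Fin n) → Matrix (Fin n) (Fin n) ℝ} (hW : MatSmoothOn W U)
    (i k : Fin n) :
    matPd i (fun y => matPd k W y + connMat G k y * W y) x
        + connMat G i x * (matPd k W x + connMat G k x * W x)
      - (matPd k (fun y => matPd i W y + connMat G i y * W y) x
        + connMat G k x * (matPd i W x + connMat G i x * W x))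
      = curvMat G i k x * W x := by
  have e : ∀ a b, matPd a (fun y => matPd b W y + connMat G b y * W y) x
      = matPd a (matPd b W) x + (matPd a (connMat G b) x * W x + connMat G b x * matPd a W x) := by
    intro a b
    rw [matPd_add h.isOpen hx (hW.matPd h.isOpen b) ((h.smooth_conn b).mul hW),
      matPd_mul h.isOpen hx (h.smooth_conn b) hW]
  rw [e, e, matPd_comm h.isOpen hx hW k i, curvMat_eq]
  noncomm_ring

variable {V : EuclideanSpace ℝ (Fin n) → Fin n → ℝ}

lemma smooth_covDerivComp (h : IsMetricOn G U) (hV : ∀ i, ContDiffOn ℝ ∞ (fun y => V y i) U)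
    (i k : Fin n) : ContDiffOn ℝ ∞ (covDerivComp G V i k) U :=
  (smoothOn_pd h.isOpen (hV i) k).add
    (ContDiffOn.sum fun s _ => (h.smooth_christoffel i k s).mul (hV s))

lemma ricci_identity (h : IsMetricOn G U) (hx : x ∈ U)
    (hV : ∀ i, ContDiffOn ℝ ∞ (fun y => V y i) U) (i k a : Fin n) :
    (pd i (covDerivComp G V a k) x + ∑ s, christoffel G a i s x * covDerivComp G V s k x)
      - (pd k (covDerivComp G V a i) x + ∑ s, christoffel G a k s x * covDerivComp G V s i x)
      = ∑ s, riemann G i k s a x * V x s := by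
  -- V enters the matrix identity as the matrix all of whose columns equal V; any column may then be
  -- read off.
  have h1 := congrFun (congrFun (h.ricci_identity_mat hx
    (W := fun y => Matrix.of fun b _ => V y b) (fun b _ => hV b) i k) a) a
  have e : ∀ (k : Fin n) (y : EuclideanSpace ℝ (Fin n)),
      matPd k (fun y => Matrix.of fun b (_ : Fin n) => V y b) y
      + connMat G k y * Matrix.of (fun b (_ : Fin n) => V y b)
      = Matrix.of fun b (_ : Fin n) => covDerivComp G V b k y := by
    intro k y
    ext b c
    simp [matPd, Matrix.mul_apply, connMat, covDerivComp]
  simp only [e] at h1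
  simpa [matPd, Matrix.mul_apply, connMat, curvMat] using h1

/-- The Bochner commutation `∇_i ∇_k V^i = ∂_k (div V) + Ric_{ks} V^s`. -/
lemma divMixed_covDeriv (h : IsMetricOn G U) (hx : x ∈ U)
    (hV : ∀ i, ContDiffOn ℝ ∞ (fun y => V y i) U) (k : Fin n) :
    divMixed G (covDerivComp G V) k x
      = pd k (fun y => ∑ i, covDerivComp G V i i y) x + ∑ s, ricciComp G k s x * V x s := by
  have h1 : ∑ i, ((pd i (covDerivComp G V i k) x
        + ∑ s, christoffel G i i s x * covDerivComp G V s k x)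
      - (pd k (covDerivComp G V i i) x + ∑ s, christoffel G i k s x * covDerivComp G V s i x))
      = ∑ i, ∑ s, riemann G i k s i x * V x s :=
    Finset.sum_congr rfl fun i _ => h.ricci_identity hx hV i k i
  simp only [Finset.sum_sub_distrib, Finset.sum_add_distrib] at h1
  rw [pd_sum _ fun i _ => differentiableAt_of_smoothOn h.isOpen hx
    (h.smooth_covDerivComp hV i i), divMixed]
  have h2 : ∑ s, ricciComp G k s x * V x s = ∑ i, ∑ s, riemann G i k s i x * V x s := by
    simp only [ricciComp, Finset.sum_mul]
    rw [Finset.sum_comm]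
  rw [h2, ← h1]
  ring

end IsMetricOn

end Coord
-- Hessian, gradient and the differential consequence of the Einstein equation
namespace Coord

variable {n : ℕ}

/-- The `(lam, n + m)`-Einstein equation for `(G, u)` on `U`, in components. -/
def EinsteinOn (G : EuclideanSpace ℝ (Fin n) → Matrix (Fin n) (Fin n) ℝ)
    (u : EuclideanSpace ℝ (Fin n) → ℝ) (lam m : ℝ) (U : Set (EuclideanSpace ℝ (Fin n))) : Prop :=
  ∀ x ∈ U, ∀ i j, ricciComp G i j x + hessComp G u i j x - 1 / m * (pd i u x * pd j u x)
    = lam * G x i j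

namespace IsMetricOn

variable {G : EuclideanSpace ℝ (Fin n) → Matrix (Fin n) (Fin n) ℝ}
  {U : Set (EuclideanSpace ℝ (Fin n))} {x : EuclideanSpace ℝ (Fin n)}
  {u : EuclideanSpace ℝ (Fin n) → ℝ} {lam m : ℝ}

lemma smooth_grad (h : IsMetricOn G U) (hu : ContDiffOn ℝ ∞ u U) (i : Fin n) :
    ContDiffOn ℝ ∞ (fun y => grad G u y i) U :=
  ContDiffOn.sum fun j _ => (h.smooth_inv i j).mul (smoothOn_pd h.isOpen hu j)

lemma grad_eq_mulVec : grad G u x = (G x)⁻¹.mulVec fun j => pd j u x := rfl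

lemma sum_metric_grad (h : IsMetricOn G U) (hx : x ∈ U) (l : Fin n) :
    ∑ i, G x l i * grad G u x i = pd l u x := by
  have : (G x).mulVec (grad G u x) = fun j => pd j u x := by
    rw [grad_eq_mulVec, Matrix.mulVec_mulVec, h.mul_inv hx, Matrix.one_mulVec]
  exact congrFun this l

lemma hessComp_symm (h : IsMetricOn G U) (hx : x ∈ U) (hu : ContDiffOn ℝ ∞ u U) (i j : Fin n) :
    hessComp G u i j x = hessComp G u j i x := by
  simp only [hessComp, pd_comm h.isOpen hx hu i j, h.christoffel_symm _ i j]

lemma pd_metric (h : IsMetricOn G U) (hx : x ∈ U) (i a b : Fin n) :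
    pd i (fun y => G y a b) x
      = ∑ s, christoffel G s i a x * G x s b + ∑ s, G x a s * christoffel G s i b x := by
  have := congrFun (congrFun (h.matPd_metric hx i) a) b
  simpa [matPd, Matrix.mul_apply, connMat] using this

/-- Differentiate ∂_l u = g_{li}(∇u)^i. Of the two Christoffel terms from ∂_k g, one is the
correction in the Hessian and the other completes ∇_k(∇u)^i. -/
lemma hessComp_eq (h : IsMetricOn G U) (hx : x ∈ U) (hu : ContDiffOn ℝ ∞ u U) (k l : Fin n) :
    hessComp G u k l x = ∑ i, G x l i * covDerivComp G (grad G u) i k x := by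
  have hG : ∀ a b, DifferentiableAt ℝ (fun y => G y a b) x := fun a b =>
    differentiableAt_of_smoothOn h.isOpen hx (h.smooth a b)
  have hV : ∀ a, DifferentiableAt ℝ (fun y => grad G u y a) x := fun a =>
    differentiableAt_of_smoothOn h.isOpen hx (h.smooth_grad hu a)
  have h1 : pd k (pd l u) x = ∑ i, (pd k (fun y => G y l i) x * grad G u x i
      + G x l i * pd k (fun y => grad G u y i) x) := by
    rw [← pd_congr h.isOpen hx (fun y hy => h.sum_metric_grad hy l) k,
      pd_sum _ fun i _ => (hG l i).fun_mul (hV i)]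
    exact Finset.sum_congr rfl fun i _ => pd_mul (hG l i) (hV i) k
  have h2 : ∑ i, pd k (fun y => G y l i) x * grad G u x i
      = ∑ s, christoffel G s k l x * pd s u x
        + ∑ i, G x l i * ∑ s, christoffel G i k s x * grad G u x s := by
    simp only [h.pd_metric hx, add_mul, Finset.sum_add_distrib]
    congr 1
    · simp only [Finset.sum_mul, ← h.sum_metric_grad hx (u := u), Finset.mul_sum]
      rw [Finset.sum_comm]
      exact Finset.sum_congr rfl fun s _ => Finset.sum_congr rfl fun i _ => by ring
    · simp only [Finset.sum_mul, Finset.mul_sum]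
      rw [Finset.sum_comm]
      exact Finset.sum_congr rfl fun s _ => Finset.sum_congr rfl fun i _ => by ring
  simp only [hessComp, h1, covDerivComp, mul_add, Finset.sum_add_distrib, h2]
  ring

lemma covDerivComp_grad_eq (h : IsMetricOn G U) (hx : x ∈ U) (hu : ContDiffOn ℝ ∞ u U)
    (i k : Fin n) :
    covDerivComp G (grad G u) i k x = ∑ l, hessComp G u k l x * (G x)⁻¹ l i := by
  have h1 : (fun l => hessComp G u k l x)
      = (G x).mulVec fun i => covDerivComp G (grad G u) i k x :=
    funext fun l => h.hessComp_eq hx hu k l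
  have h2 := congrArg (fun v => (G x)⁻¹.mulVec v i) h1
  simp only [Matrix.mulVec_mulVec, h.inv_mul hx, Matrix.one_mulVec] at h2
  rw [← h2, Matrix.mulVec, dotProduct]
  exact Finset.sum_congr rfl fun l _ => by rw [h.inv_symm x i l, mul_comm]

lemma sum_pd_mul_covDerivComp (h : IsMetricOn G U) (hx : x ∈ U) (hu : ContDiffOn ℝ ∞ u U)
    (k : Fin n) :
    ∑ i, pd i u x * covDerivComp G (grad G u) i k x
      = ∑ l, hessComp G u k l x * grad G u x l := by
  simp only [h.hessComp_eq hx hu, ← h.sum_metric_grad hx (u := u), Finset.sum_mul]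
  rw [Finset.sum_comm]
  exact Finset.sum_congr rfl fun s _ => Finset.sum_congr rfl fun i _ => by
    rw [h.symm x i s]; ring

/-- `∂_k |∇u|² = 2 Hess u (∂_k, ∇u)`. -/
lemma pd_sum_pd_mul_grad (h : IsMetricOn G U) (hx : x ∈ U) (hu : ContDiffOn ℝ ∞ u U)
    (k : Fin n) :
    pd k (fun y => ∑ i, pd i u y * grad G u y i) x
      = 2 * ∑ l, hessComp G u k l x * grad G u x l := by
  have hf : ∀ a, DifferentiableAt ℝ (pd a u) x := fun a =>
    differentiableAt_of_smoothOn h.isOpen hx (smoothOn_pd h.isOpen hu a)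
  have hV : ∀ a, DifferentiableAt ℝ (fun y => grad G u y a) x := fun a =>
    differentiableAt_of_smoothOn h.isOpen hx (h.smooth_grad hu a)
  rw [pd_sum _ fun i _ => (hf i).fun_mul (hV i), two_mul]
  nth_rewrite 2 [← h.sum_pd_mul_covDerivComp hx hu]
  simp only [hessComp, covDerivComp, sub_mul, mul_add, Finset.sum_sub_distrib,
    Finset.sum_add_distrib, pd_mul (hf _) (hV _)]
  have : ∑ i, (∑ s, christoffel G s k i x * pd s u x) * grad G u x i
      = ∑ i, pd i u x * ∑ s, christoffel G i k s x * grad G u x s := by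
    simp only [Finset.sum_mul, Finset.mul_sum]
    rw [Finset.sum_comm]
    exact Finset.sum_congr rfl fun s _ => Finset.sum_congr rfl fun i _ => by ring
  rw [this]
  ring

/-- The divergence of `du ⊗ ∇u`. -/
lemma divMixed_pd_mul_grad (h : IsMetricOn G U) (hx : x ∈ U) (hu : ContDiffOn ℝ ∞ u U)
    (k : Fin n) :
    divMixed G (fun i k y => pd k u y * grad G u y i) k x
      = pd k u x * (∑ i, covDerivComp G (grad G u) i i x)
        + ∑ l, hessComp G u k l x * grad G u x l := by
  have hf : ∀ a, DifferentiableAt ℝ (pd a u) x := fun a =>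
    differentiableAt_of_smoothOn h.isOpen hx (smoothOn_pd h.isOpen hu a)
  have hV : ∀ a, DifferentiableAt ℝ (fun y => grad G u y a) x := fun a =>
    differentiableAt_of_smoothOn h.isOpen hx (h.smooth_grad hu a)
  simp only [divMixed, pd_mul (hf _) (hV _), Finset.sum_add_distrib, h.hessComp_symm hx hu k]
  simp only [hessComp, covDerivComp, sub_mul, mul_add, Finset.sum_sub_distrib,
    Finset.sum_add_distrib]
  have e1 : ∑ i, ∑ s, christoffel G i i s x * (pd k u x * grad G u x s)
      = pd k u x * ∑ i, ∑ s, christoffel G i i s x * grad G u x s := by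
    simp only [Finset.mul_sum]
    exact Finset.sum_congr rfl fun s _ => Finset.sum_congr rfl fun i _ => by ring
  have e2 : ∑ i, ∑ s, christoffel G i k s x * (pd i u x * grad G u x s)
      = ∑ i, (∑ s, christoffel G s i k x * pd s u x) * grad G u x i := by
    simp only [Finset.sum_mul]
    rw [Finset.sum_comm]
    exact Finset.sum_congr rfl fun s _ => Finset.sum_congr rfl fun i _ => by
      rw [h.christoffel_symm i k s]; ring
  rw [e1, e2, Finset.mul_sum Finset.univ (fun i => pd i (fun y => grad G u y i) x)]
  ring

/-- The identity endomorphism is parallel: the two Christoffel sums agree by symmetry of the lower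
indices. Thus λg contributes nothing to the divergence. -/
lemma divMixed_delta (h : IsMetricOn G U) (c : ℝ) (k : Fin n) :
    divMixed G (fun i k _ => if i = k then c else 0) k x = 0 := by
  simp only [divMixed, mul_ite, mul_zero, Finset.sum_ite_eq', Finset.mem_univ, if_true, pd_const,
    Finset.sum_const_zero, zero_add, h.christoffel_symm _ k, sub_self]

/-- The Einstein equation with one index raised, the form in which its divergence and its trace are
taken. -/
lemma ricciMixed_of_einstein (h : IsMetricOn G U) (hu : ContDiffOn ℝ ∞ u U)
    (hE : EinsteinOn G u lam m U) (hx : x ∈ U) (i k : Fin n) :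
    ricciMixed G i k x = (if i = k then lam else 0) - covDerivComp G (grad G u) i k x
      + 1 / m * (pd k u x * grad G u x i) := by
  rw [ricciMixed_eq, h.covDerivComp_grad_eq hx hu]
  have h1 : ∀ s, ricciComp G k s x = lam * G x k s - hessComp G u k s x
      + 1 / m * (pd k u x * pd s u x) := fun s => by linarith [hE x hx k s]
  simp only [h1, add_mul, sub_mul, Finset.sum_add_distrib, Finset.sum_sub_distrib]
  have e1 : ∑ s, lam * G x k s * (G x)⁻¹ s i = if i = k then lam else 0 := by
    have := congrFun (congrFun (h.mul_inv hx) k) i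
    rw [Matrix.mul_apply] at this
    simp only [mul_assoc, ← Finset.mul_sum, this, Matrix.one_apply, mul_ite, mul_one, mul_zero,
      eq_comm]
  have e2 : ∑ s, 1 / m * (pd k u x * pd s u x) * (G x)⁻¹ s i
      = 1 / m * (pd k u x * grad G u x i) := by
    rw [grad, Finset.mul_sum, Finset.mul_sum]
    exact Finset.sum_congr rfl fun s _ => by rw [h.inv_symm x s i]; ring
  rw [e1, e2]

lemma divMixed_congr (h : IsMetricOn G U) (hx : x ∈ U)
    {A B : Fin n → Fin n → EuclideanSpace ℝ (Fin n) → ℝ} (hAB : ∀ y ∈ U, ∀ i k, A i k y = B i k y)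
    (k : Fin n) : divMixed G A k x = divMixed G B k x := by
  simp only [divMixed, hAB x hx, fun i => pd_congr h.isOpen hx (fun y hy => hAB y hy i k) i]

lemma divMixed_add
    {A B : Fin n → Fin n → EuclideanSpace ℝ (Fin n) → ℝ}
    (hA : ∀ i k, DifferentiableAt ℝ (A i k) x) (hB : ∀ i k, DifferentiableAt ℝ (B i k) x)
    (c : ℝ) (k : Fin n) :
    divMixed G (fun i k y => A i k y + c * B i k y) k x
      = divMixed G A k x + c * divMixed G B k x := by
  have e : ∀ i, pd i (fun y => A i k y + c * B i k y) x
      = pd i (A i k) x + c * pd i (B i k) x := fun i => by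
    rw [pd_add (hA i k) ((hB i k).const_mul c), pd_const_mul (hB i k)]
  have e2 : ∀ a b c' : ℝ, a * (b + c * c') = a * b + c * (a * c') := fun a b c' => by ring
  simp only [divMixed, e, e2, Finset.sum_add_distrib, ← Finset.mul_sum]
  ring

/-- On a `(lam, n + m)`-Einstein manifold,
`½ dS = ((m - 1) / m) Ric(∇u) + ((S - (n - 1) lam) / m) du`. -/
lemma pd_scal_of_einstein (h : IsMetricOn G U) (hu : ContDiffOn ℝ ∞ u U) (hm : m ≠ 0)
    (hE : EinsteinOn G u lam m U) (hx : x ∈ U) (k : Fin n) :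
    1 / 2 * pd k (scal G) x = (m - 1) / m * ∑ s, ricciComp G k s x * grad G u x s
      + (scal G x - (n - 1) * lam) / m * pd k u x := by
  have hV := h.smooth_grad hu
  have sH := h.smooth_covDerivComp hV
  have sF : ∀ i k, ContDiffOn ℝ ∞ (fun y => pd k u y * grad G u y i) U := fun i k =>
    (smoothOn_pd h.isOpen hu k).mul (hV i)
  have dd : ∀ {a : EuclideanSpace ℝ (Fin n) → ℝ}, ContDiffOn ℝ ∞ a U → DifferentiableAt ℝ a x :=
    fun ha => differentiableAt_of_smoothOn h.isOpen hx ha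
  -- The divergence of the Einstein equation.
  have hdiv : 1 / 2 * pd k (scal G) x
      + (pd k (fun y => ∑ i, covDerivComp G (grad G u) i i y) x
        + ∑ s, ricciComp G k s x * grad G u x s)
      - 1 / m * (pd k u x * (∑ i, covDerivComp G (grad G u) i i x)
        + ∑ l, hessComp G u k l x * grad G u x l) = 0 := by
    rw [← h.divMixed_ricci hx, ← h.divMixed_covDeriv hx hV, ← h.divMixed_pd_mul_grad hx hu]
    have e := h.divMixed_congr hx (A := ricciMixed G) (B := fun i k y =>
      ((if i = k then lam else 0) + (-1) * covDerivComp G (grad G u) i k y)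
      + 1 / m * (pd k u y * grad G u y i))
      (fun y hy i k => by rw [h.ricciMixed_of_einstein hu hE hy]; ring) k
    rw [e, divMixed_add (A := fun i k y => ((if i = k then lam else 0)
        + (-1) * covDerivComp G (grad G u) i k y))
        (fun i k => (differentiableAt_const _).fun_add ((dd (sH i k)).const_mul _))
        (fun i k => dd (sF i k)),
      divMixed_add (A := fun i k _ => if i = k then lam else 0)
        (fun i k => differentiableAt_const _) (fun i k => dd (sH i k)), h.divMixed_delta]
    ring
  -- The trace of the equation, needed on all of U because it is differentiated next.
  have htr : ∀ y ∈ U, scal G y = n * lam - ∑ i, covDerivComp G (grad G u) i i y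
      + 1 / m * ∑ i, pd i u y * grad G u y i := by
    intro y hy
    rw [h.scal_eq]
    simp [h.ricciMixed_of_einstein hu hE hy, Finset.sum_add_distrib, Finset.mul_sum]
  have hdtr : pd k (scal G) x = -pd k (fun y => ∑ i, covDerivComp G (grad G u) i i y) x
      + 1 / m * (2 * ∑ l, hessComp G u k l x * grad G u x l) := by
    have s1 : ContDiffOn ℝ ∞ (fun y => ∑ i, covDerivComp G (grad G u) i i y) U :=
      ContDiffOn.sum fun i _ => sH i i
    have s2 : ContDiffOn ℝ ∞ (fun y => ∑ i, pd i u y * grad G u y i) U :=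
      ContDiffOn.sum fun i _ => sF i i
    rw [pd_congr h.isOpen hx htr,
      pd_add ((differentiableAt_const _).fun_sub (dd s1)) ((dd s2).const_mul _),
      pd_sub (differentiableAt_const _) (dd s1), pd_const_mul (dd s2),
      h.pd_sum_pd_mul_grad hx hu, pd_const]
    ring
  -- The equation contracted with ∇u. With this and the trace, Δu, its differential and Hess u(∇u)
  -- are eliminated from the divergence, and the |∇u|² terms cancel.
  have hHV : ∑ l, hessComp G u k l x * grad G u x l = lam * pd k u x
      - ∑ s, ricciComp G k s x * grad G u x s
      + 1 / m * (pd k u x * ∑ i, pd i u x * grad G u x i) := by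
    have h1 : ∀ s, hessComp G u k s x = lam * G x k s - ricciComp G k s x
      + 1 / m * (pd k u x * pd s u x) := fun s => by linarith [hE x hx k s]
    simp only [h1, add_mul, sub_mul, Finset.sum_add_distrib, Finset.sum_sub_distrib, mul_assoc,
      ← Finset.mul_sum, h.sum_metric_grad hx]
  have htx := htr x hx
  generalize (∑ i, covDerivComp G (grad G u) i i x) = dV at *
  generalize (∑ l, hessComp G u k l x * grad G u x l) = HV at *
  generalize (∑ i, pd i u x * grad G u x i) = q at *
  generalize (∑ s, ricciComp G k s x * grad G u x s) = RV at *
  generalize pd k (fun y => ∑ i, covDerivComp G (grad G u) i i y) x = ddV at *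
  generalize pd k (scal G) x = dS at *
  generalize scal G x = S at *
  have hdV : dV = n * lam - S + 1 / m * q := by linarith
  subst hHV hdV
  have hddV : ddV = -dS + 1 / m * (2 * (lam * pd k u x - RV + 1 / m * (pd k u x * q))) := by
    linarith
  subst hddV
  field_simp at hdiv ⊢
  refine mul_left_cancel₀ hm ?_
  linarith

end IsMetricOn

end Coord
/-! ### Pointwise Euclidean algebra -/

section Euclidean

variable {n : ℕ}

/-- D is an antisymmetrization X_{ijk} - X_{jik}, so its norm needs only |X|² and one cross term. -/
lemma sum_sq_sub_swap (X : Fin n → Fin n → Fin n → ℝ) :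
    ∑ i, ∑ j, ∑ k, (X i j k - X j i k) ^ 2
      = 2 * (∑ i, ∑ j, ∑ k, X i j k ^ 2 - ∑ i, ∑ j, ∑ k, X i j k * X j i k) := by
  have e : ∑ i, ∑ j, ∑ k, X j i k ^ 2 = ∑ i, ∑ j, ∑ k, X i j k ^ 2 := Finset.sum_comm
  have e2 : ∀ i j k, (X i j k - X j i k) ^ 2 = X i j k ^ 2 - 2 * (X i j k * X j i k)
      + X j i k ^ 2 := fun i j k => by ring
  simp only [e2, Finset.sum_add_distrib, Finset.sum_sub_distrib, ← Finset.mul_sum, e]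
  ring

/-- `|D|²` for `D_{ijk} = A_i δ_{jk} - A_j δ_{ik} + β (R_{jk} v_i - R_{ik} v_j)`. -/
lemma sum_sq_cotton_type (R : Fin n → Fin n → ℝ) (hR : ∀ i j, R i j = R j i) (A v : Fin n → ℝ)
    (β : ℝ) :
    ∑ i, ∑ j, ∑ k, ((A i * (if j = k then 1 else 0) - A j * (if i = k then 1 else 0))
        + β * (R j k * v i - R i k * v j)) ^ 2
      = 2 * ((n - 1) * ∑ i, A i ^ 2 + 2 * β * (∑ i, R i i) * ∑ i, A i * v i
        - 2 * β * ∑ i, A i * ∑ j, R i j * v j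
        + β ^ 2 * ((∑ i, ∑ j, R i j ^ 2) * (∑ i, v i ^ 2) - ∑ i, (∑ j, R i j * v j) ^ 2)) := by
  have h := sum_sq_sub_swap fun i j k => A i * (if j = k then 1 else 0) + β * (R j k * v i)
  have h1 : ∑ i, ∑ j, ∑ k, (A i * (if j = k then 1 else 0) + β * (R j k * v i)) ^ 2
      = n * ∑ i, A i ^ 2 + 2 * β * (∑ i, R i i) * (∑ i, A i * v i)
        + β ^ 2 * ((∑ i, ∑ j, R i j ^ 2) * ∑ i, v i ^ 2) := by
    have e : ∀ i j k, (A i * (if j = k then 1 else 0) + β * (R j k * v i)) ^ 2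
        = (if j = k then A i ^ 2 + 2 * β * (A i * v i) * R j k else 0)
          + β ^ 2 * v i ^ 2 * R j k ^ 2 := fun i j k => by split_ifs <;> ring
    simp only [e, Finset.sum_add_distrib, Finset.sum_ite_eq, Finset.mem_univ, if_true,
      Finset.sum_const, Finset.card_univ, Fintype.card_fin, nsmul_eq_mul, ← Finset.mul_sum,
      ← Finset.sum_mul]
    ring
  have h2 : ∑ i, ∑ j, ∑ k, (A i * (if j = k then 1 else 0) + β * (R j k * v i))
        * (A j * (if i = k then 1 else 0) + β * (R i k * v j))
      = ∑ i, A i ^ 2 + 2 * β * (∑ i, A i * ∑ j, R i j * v j)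
        + β ^ 2 * ∑ i, (∑ j, R i j * v j) ^ 2 := by
    have e : ∀ i j k, (A i * (if j = k then 1 else 0) + β * (R j k * v i))
        * (A j * (if i = k then 1 else 0) + β * (R i k * v j))
        = (if j = k then (if i = k then A i * A j else 0) else 0)
          + (if j = k then β * (A i * (R i k * v j)) else 0)
          + (if i = k then β * (A j * (R j k * v i)) else 0)
          + β ^ 2 * ((R k i * v i) * (R k j * v j)) := fun i j k => by
      rw [hR k i, hR k j]; split_ifs <;> ring
    have e3 : ∑ i, ∑ j, ∑ k, (R k i * v i) * (R k j * v j) = ∑ k, (∑ j, R k j * v j) ^ 2 := by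
      simp only [sq, Finset.sum_mul_sum]
      rw [Finset.sum_congr rfl fun i _ => Finset.sum_comm, Finset.sum_comm]
    have e4 : ∑ i, ∑ j, A j * (R j i * v i) = ∑ i, A i * ∑ j, R i j * v j := by
      rw [Finset.sum_comm]; simp only [Finset.mul_sum]
    simp only [e, Finset.sum_add_distrib, Finset.sum_ite_eq, Finset.mem_univ, if_true,
      ← Finset.mul_sum, e3, e4, ← sq]
    ring
  simp only [mul_assoc] at h h1 h2 ⊢
  rw [h1, h2] at h
  have h3 : ∀ i j k, A i * (if j = k then 1 else 0) - A j * (if i = k then 1 else 0)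
        + β * (R j k * v i - R i k * v j)
      = A i * (if j = k then 1 else 0) + β * (R j k * v i)
        - (A j * (if i = k then 1 else 0) + β * (R i k * v j)) := fun i j k => by ring
  simp only [h3, h]
  ring

/-- An orthonormal family of `n - 1` vectors orthogonal to `v ≠ 0` resolves the projection to the
orthogonal complement of `v`. -/
lemma sum_mul_of_orthonormal (hn : 1 ≤ n) (v : Fin n → ℝ) (hv : ∑ i, v i ^ 2 ≠ 0)
    (c : Fin (n - 1) → Fin n → ℝ) (hc : ∀ a b, ∑ i, c a i * c b i = if a = b then 1 else 0)
    (hcv : ∀ a, ∑ i, c a i * v i = 0) (i j : Fin n) :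
    ∑ a, c a i * c a j = (if i = j then 1 else 0) - v i * v j / ∑ i, v i ^ 2 := by
  set q := ∑ i, v i ^ 2 with hq
  -- The family c is completed to a basis by v, at index `none`, with dual vector v/q in B. Both
  -- index types have n elements, so AB = 1 forces BA = 1, whose entries are the claim.
  let A : Matrix (Option (Fin (n - 1))) (Fin n) ℝ :=
    Matrix.of fun o i => o.elim (v i) fun a => c a i
  let B : Matrix (Fin n) (Option (Fin (n - 1))) ℝ :=
    Matrix.of fun i o => o.elim (v i / q) fun a => c a i
  have hAB : A * B = 1 := by
    ext o o'
    rw [Matrix.mul_apply, Matrix.one_apply]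
    rcases o with _ | a <;> rcases o' with _ | b
    · simp only [A, B, Matrix.of_apply, Option.elim, if_true, mul_div_assoc', ← sq,
        ← Finset.sum_div, ← hq]
      exact div_self hv
    · simpa [A, B, mul_comm] using hcv b
    · simp only [A, B, Matrix.of_apply, Option.elim, mul_div_assoc', ← Finset.sum_div, hcv]
      simp
    · simpa [A, B] using hc a b
  have hBA := (Matrix.mul_eq_one_comm_of_card_eq _ _ _ (by simp; omega)).1 hAB
  have := congrFun (congrFun hBA i) j
  rw [Matrix.mul_apply, Fintype.sum_option, Matrix.one_apply] at this
  simp only [A, B, Matrix.of_apply, Option.elim] at this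
  rw [← this]
  ring

/-- The squared norm of the trace-free part of a symmetric form restricted to the orthogonal
complement of `v`. -/
lemma sum_sq_tracefree_restrict (hn : 2 ≤ n) (R : Fin n → Fin n → ℝ) (hR : ∀ i j, R i j = R j i)
    (v : Fin n → ℝ) (hv : ∑ i, v i ^ 2 ≠ 0)
    (c : Fin (n - 1) → Fin n → ℝ) (hc : ∀ a b, ∑ i, c a i * c b i = if a = b then 1 else 0)
    (hcv : ∀ a, ∑ i, c a i * v i = 0) :
    ∑ a, ∑ b, ((∑ i, ∑ j, R i j * c a i * c b j)
        - (∑ d, ∑ i, ∑ j, R i j * c d i * c d j) / ((n : ℝ) - 1) * (if a = b then 1 else 0)) ^ 2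
      = ∑ i, ∑ j, R i j ^ 2 - 2 * (∑ i, (∑ j, R i j * v j) ^ 2) / (∑ i, v i ^ 2)
        + (∑ i, v i * ∑ j, R i j * v j) ^ 2 / (∑ i, v i ^ 2) ^ 2
        - (∑ i, R i i - (∑ i, v i * ∑ j, R i j * v j) / (∑ i, v i ^ 2)) ^ 2 / ((n : ℝ) - 1) := by
  set q := ∑ i, v i ^ 2 with hq
  have hK := sum_mul_of_orthonormal (by omega) v hv c hc hcv
  rw [← hq] at hK
  set T : Fin (n - 1) → Fin (n - 1) → ℝ := fun a b => ∑ i, ∑ j, R i j * c a i * c b j with hT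
  have hn1 : ((n : ℝ) - 1) ≠ 0 := by
    have : (2 : ℝ) ≤ n := by exact_mod_cast hn
    linarith
  have hcard : ((n - 1 : ℕ) : ℝ) = (n : ℝ) - 1 := by
    rw [Nat.cast_sub (by omega), Nat.cast_one]
  have htrace : ∑ a, T a a = ∑ i, R i i - (∑ i, v i * ∑ j, R i j * v j) / q := by
    have e : ∑ a, T a a = ∑ i, ∑ j, R i j * ∑ a, c a i * c a j := by
      simp only [hT, Finset.mul_sum]
      rw [Finset.sum_comm]
      refine Finset.sum_congr rfl fun i _ => ?_
      rw [Finset.sum_comm]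
      exact Finset.sum_congr rfl fun j _ => Finset.sum_congr rfl fun a _ => by ring
    rw [e]
    simp only [hK, mul_sub, mul_ite, mul_one, mul_zero, Finset.sum_sub_distrib, Finset.sum_ite_eq,
      Finset.mem_univ, if_true]
    congr 1
    rw [Finset.sum_div]
    refine Finset.sum_congr rfl fun i _ => ?_
    rw [Finset.mul_sum, Finset.sum_div]
    exact Finset.sum_congr rfl fun j _ => by ring
  have hsq : ∑ a, ∑ b, T a b ^ 2 = ∑ i, ∑ j, R i j ^ 2
      - 2 * (∑ i, (∑ j, R i j * v j) ^ 2) / q + (∑ i, v i * ∑ j, R i j * v j) ^ 2 / q ^ 2 := by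
    -- Parseval on the complement of v, applied below once in each index of R.
    have s2 : ∀ w : Fin n → ℝ, ∑ a, (∑ i, w i * c a i) ^ 2
        = ∑ i, w i ^ 2 - (∑ i, v i * w i) ^ 2 / q := by
      intro w
      simp only [sq (∑ j, _ * c _ j), Finset.sum_mul_sum]
      rw [Finset.sum_comm, Finset.sum_congr rfl fun i _ => Finset.sum_comm]
      have t2 : ∀ j k, ∑ b, w j * c b j * (w k * c b k)
          = w j * w k * ((if j = k then 1 else 0) - v j * v k / q) := fun j k => by
        rw [← hK, Finset.mul_sum]
        exact Finset.sum_congr rfl fun b _ => by ring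
      simp only [t2, mul_sub, mul_ite, mul_one, mul_zero, Finset.sum_sub_distrib,
        Finset.sum_ite_eq, Finset.mem_univ, if_true, ← sq]
      congr 1
      rw [sq, Finset.sum_mul_sum, Finset.sum_div]
      refine Finset.sum_congr rfl fun j _ => ?_
      rw [Finset.sum_div]
      exact Finset.sum_congr rfl fun k _ => by ring
    have s1 : ∀ a, ∑ b, T a b ^ 2 = ∑ j, (∑ i, R i j * c a i) ^ 2
        - (∑ j, (∑ i, R i j * v j * c a i)) ^ 2 / q := by
      intro a
      have t1 : ∀ b, T a b = ∑ j, (∑ i, R i j * c a i) * c b j := fun b => by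
        simp only [hT, Finset.sum_mul]
        exact Finset.sum_comm
      simp only [t1, s2]
      congr 3
      refine Finset.sum_congr rfl fun j _ => ?_
      rw [Finset.mul_sum]
      exact Finset.sum_congr rfl fun b _ => by ring
    simp only [s1, Finset.sum_sub_distrib, ← Finset.sum_div]
    have s3 : ∀ a, ∑ j, ∑ i, R i j * v j * c a i = ∑ i, (∑ j, R i j * v j) * c a i := fun a => by
      rw [Finset.sum_comm]
      simp only [Finset.sum_mul]
    rw [Finset.sum_comm]
    simp only [s2, s3, Finset.sum_sub_distrib, ← Finset.sum_div]
    have s4 : ∀ j, ∑ i, v i * R i j = ∑ i, R j i * v i := fun j =>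
      Finset.sum_congr rfl fun i _ => by rw [hR, mul_comm]
    simp only [s4]
    rw [Finset.sum_comm]
    field_simp
    ring
  change ∑ a, ∑ b, (T a b - (∑ d, T d d) / ((n : ℝ) - 1) * _) ^ 2 = _
  have e : ∀ a b, (T a b - (∑ d, T d d) / ((n : ℝ) - 1) * (if a = b then 1 else 0)) ^ 2
      = T a b ^ 2 + if a = b then ((∑ d, T d d) / ((n : ℝ) - 1)) ^ 2
        - 2 * ((∑ d, T d d) / ((n : ℝ) - 1)) * T a b else 0 := fun a b => by
    split_ifs <;> ring
  simp only [e]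
  simp only [Finset.sum_add_distrib, Finset.sum_ite_eq, Finset.mem_univ, if_true,
    Finset.sum_sub_distrib, Finset.sum_const, Finset.card_univ, Fintype.card_fin, nsmul_eq_mul,
    ← Finset.mul_sum, hcard, hsq, htrace]
  field_simp
  ring

end Euclidean
section Euclidean

variable {n : ℕ}

/-- The norm of the `D`-tensor in an orthonormal frame, in terms of the trace-free Ricci form on
the orthogonal complement of `v` and the tangential part of `Ric(v)`. -/
lemma sum_sq_dTensor_frame (hn : 3 ≤ n) (R : Fin n → Fin n → ℝ) (hR : ∀ i j, R i j = R j i)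
    (v : Fin n → ℝ) (hv : ∑ i, v i ^ 2 ≠ 0)
    (c : Fin (n - 1) → Fin n → ℝ) (hc : ∀ a b, ∑ i, c a i * c b i = if a = b then 1 else 0)
    (hcv : ∀ a, ∑ i, c a i * v i = 0) :
    ∑ i, ∑ j, ∑ k, (1 / (((n : ℝ) - 1) * ((n : ℝ) - 2)) *
        ((∑ l, R i l * v l) * (if j = k then 1 else 0)
          - (∑ l, R j l * v l) * (if i = k then 1 else 0))
      + 1 / ((n : ℝ) - 2) * (R j k * v i - R i k * v j)
      - (∑ l, R l l) / (((n : ℝ) - 1) * ((n : ℝ) - 2)) *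
        (v i * (if j = k then 1 else 0) - v j * (if i = k then 1 else 0))) ^ 2
      = 2 * (∑ i, v i ^ 2) / ((n : ℝ) - 2) ^ 2 *
          ∑ a, ∑ b, ((∑ i, ∑ j, R i j * c a i * c b j)
            - (∑ d, ∑ i, ∑ j, R i j * c d i * c d j) / ((n : ℝ) - 1)
              * (if a = b then 1 else 0)) ^ 2
        + 2 / (((n : ℝ) - 1) * ((n : ℝ) - 2)) * (∑ i, (∑ l, R i l * v l) ^ 2
          - (∑ i, v i * ∑ l, R i l * v l) ^ 2 / ∑ i, v i ^ 2) := by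
  have hn' : (3 : ℝ) ≤ n := by exact_mod_cast hn
  have h1 : (n : ℝ) - 1 ≠ 0 := by linarith
  have h2 : (n : ℝ) - 2 ≠ 0 := by linarith
  rw [sum_sq_tracefree_restrict (by omega) R hR v hv c hc hcv]
  set α : ℝ := 1 / (((n : ℝ) - 1) * ((n : ℝ) - 2)) with hα
  set S := ∑ l, R l l with hS
  -- The first and third terms of D combine into A_iδ_{jk} - A_jδ_{ik} with A = α(Rv - Sv).
  have hD := sum_sq_cotton_type R hR (fun i => α * ((∑ l, R i l * v l) - S * v i)) v
    (1 / ((n : ℝ) - 2))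
  have e : ∀ i j k, α * ((∑ l, R i l * v l) * (if j = k then 1 else 0)
          - (∑ l, R j l * v l) * (if i = k then 1 else 0))
      + 1 / ((n : ℝ) - 2) * (R j k * v i - R i k * v j)
      - S / (((n : ℝ) - 1) * ((n : ℝ) - 2)) *
        (v i * (if j = k then 1 else 0) - v j * (if i = k then 1 else 0))
      = (α * ((∑ l, R i l * v l) - S * v i) * (if j = k then 1 else 0)
          - α * ((∑ l, R j l * v l) - S * v j) * (if i = k then 1 else 0))
        + 1 / ((n : ℝ) - 2) * (R j k * v i - R i k * v j) := fun i j k => by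
    rw [div_eq_mul_one_div S, ← hα]; ring
  simp only [e]
  rw [hD]
  have a1 : ∑ i, (α * ((∑ l, R i l * v l) - S * v i)) ^ 2
      = α ^ 2 * (∑ i, (∑ l, R i l * v l) ^ 2 - 2 * S * (∑ i, v i * ∑ l, R i l * v l)
        + S ^ 2 * ∑ i, v i ^ 2) := by
    simp only [Finset.mul_sum, ← Finset.sum_sub_distrib, ← Finset.sum_add_distrib]
    refine Finset.sum_congr rfl fun i _ => ?_
    simp only [← Finset.mul_sum]
    ring
  have a2 : ∑ i, α * ((∑ l, R i l * v l) - S * v i) * v i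
      = α * ((∑ i, v i * ∑ l, R i l * v l) - S * ∑ i, v i ^ 2) := by
    simp only [Finset.mul_sum, ← Finset.sum_sub_distrib]
    refine Finset.sum_congr rfl fun i _ => ?_
    simp only [← Finset.mul_sum]
    ring
  have a3 : ∑ i, α * ((∑ l, R i l * v l) - S * v i) * (∑ l, R i l * v l)
      = α * (∑ i, (∑ l, R i l * v l) ^ 2 - S * ∑ i, v i * ∑ l, R i l * v l) := by
    simp only [Finset.mul_sum, ← Finset.sum_sub_distrib]
    refine Finset.sum_congr rfl fun i _ => ?_
    simp only [← Finset.mul_sum]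
    ring
  rw [a1, a2, a3, hα]
  -- Both sides are now rational expressions in n, S and the invariants |Rv|², ⟨v, Rv⟩, |R|², |v|².
  generalize (∑ i, (∑ l, R i l * v l) ^ 2) = P
  generalize (∑ i, v i * ∑ l, R i l * v l) = r
  generalize (∑ i, ∑ j, R i j ^ 2) = N
  generalize (∑ i, v i ^ 2) = q at *
  field_simp
  ring

end Euclidean

/-! ### Passage to orthonormal frames; the second fundamental form -/

namespace Coord

variable {n : ℕ}

/-- The bilinear form with matrix `B`. -/
def bilin (B : Matrix (Fin n) (Fin n) ℝ) (v w : Fin n → ℝ) : ℝ :=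
  ∑ i, ∑ j, B i j * v i * w j

lemma bilin_sum (B : Matrix (Fin n) (Fin n) ℝ) {ι κ : Type*} (s : Finset ι) (t : Finset κ)
    (a : ι → ℝ) (b : κ → ℝ) (X : ι → Fin n → ℝ) (Y : κ → Fin n → ℝ) :
    bilin B (fun i => ∑ p ∈ s, a p * X p i) (fun j => ∑ r ∈ t, b r * Y r j)
      = ∑ p ∈ s, ∑ r ∈ t, bilin B (X p) (Y r) * a p * b r := by
  simp only [bilin, Finset.mul_sum, Finset.sum_mul]
  calc _ = ∑ i, ∑ r ∈ t, ∑ p ∈ s, ∑ j, B i j * (a p * X p i) * (b r * Y r j) := by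
        refine Finset.sum_congr rfl fun i _ => ?_
        rw [Finset.sum_comm]
        exact Finset.sum_congr rfl fun r _ => Finset.sum_comm
    _ = ∑ r ∈ t, ∑ p ∈ s, ∑ i, ∑ j, B i j * (a p * X p i) * (b r * Y r j) := by
        rw [Finset.sum_comm]
        exact Finset.sum_congr rfl fun r _ => Finset.sum_comm
    _ = _ := by
        rw [Finset.sum_comm]
        exact Finset.sum_congr rfl fun p _ => Finset.sum_congr rfl fun r _ =>
          Finset.sum_congr rfl fun i _ => Finset.sum_congr rfl fun j _ => by ring

variable {G : EuclideanSpace ℝ (Fin n) → Matrix (Fin n) (Fin n) ℝ}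
  {U : Set (EuclideanSpace ℝ (Fin n))} {x : EuclideanSpace ℝ (Fin n)}
  {u : EuclideanSpace ℝ (Fin n) → ℝ} {lam m : ℝ} {e : Fin n → Fin n → ℝ}

/-- With E the matrix of rows e_a, orthonormality says EGEᵀ = 1; for square matrices this gives
Eᵀ(EG) = 1, which is the expansion. -/
lemma IsOrthonormal.expand (he : IsOrthonormal G x e) (w : Fin n → ℝ) :
    w = fun j => ∑ a, ip G x (e a) w * e a j := by
  have h1 : (Matrix.of e * G x) * (Matrix.of e).transpose = 1 := by
    ext a b
    rw [Matrix.one_apply, ← he a b, ip, Matrix.mul_apply]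
    simp only [Matrix.mul_apply, Matrix.of_apply, Matrix.transpose_apply, Finset.sum_mul]
    rw [Finset.sum_comm]
    exact Finset.sum_congr rfl fun i _ => Finset.sum_congr rfl fun j _ => by ring
  have h2 := mul_eq_one_comm.1 h1
  have h3 : w = ((Matrix.of e).transpose * (Matrix.of e * G x)).mulVec w := by
    rw [h2, Matrix.one_mulVec]
  funext j
  have h4 := congrFun h3 j
  rw [← Matrix.mulVec_mulVec] at h4
  refine h4.trans ?_
  rw [Matrix.mulVec, dotProduct]
  refine Finset.sum_congr rfl fun a _ => ?_
  rw [Matrix.transpose_apply, Matrix.of_apply, mul_comm]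
  congr 1
  simp only [Matrix.mulVec, dotProduct, Matrix.mul_apply, Matrix.of_apply, ip, Finset.sum_mul]
  rw [Finset.sum_comm]
  exact Finset.sum_congr rfl fun i _ => Finset.sum_congr rfl fun j _ => by ring

lemma IsOrthonormal.bilin_eq (he : IsOrthonormal G x e) (B : Matrix (Fin n) (Fin n) ℝ)
    (v w : Fin n → ℝ) :
    bilin B v w = ∑ a, ∑ b, bilin B (e a) (e b) * ip G x (e a) v * ip G x (e b) w := by
  conv_lhs => rw [he.expand v, he.expand w]
  exact bilin_sum B _ _ _ _ _ _

lemma IsOrthonormal.ip_eq (he : IsOrthonormal G x e) (v w : Fin n → ℝ) :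
    ip G x v w = ∑ a, ip G x (e a) v * ip G x (e a) w := by
  have := he.bilin_eq (G x) v w
  have h2 : ∀ a b, bilin (G x) (e a) (e b) = if a = b then 1 else 0 := he
  rw [show ip G x v w = bilin (G x) v w from rfl, this]
  simp [h2]

lemma IsOrthonormal.inv_eq (he : IsOrthonormal G x e) (hG : IsMetricOn G U) (hx : x ∈ U)
    (j k : Fin n) : (G x)⁻¹ j k = ∑ a, e a j * e a k := by
  rw [congrFun (he.expand fun j => (G x)⁻¹ j k) j]
  refine Finset.sum_congr rfl fun a _ => ?_
  rw [mul_comm]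
  congr 1
  have h1 : ∀ i, ∑ l, G x i l * (G x)⁻¹ l k = if i = k then 1 else 0 := fun i => by
    rw [← Matrix.mul_apply, hG.mul_inv hx, Matrix.one_apply]
  have h2 : ∀ i, ∑ l, G x i l * e a i * (G x)⁻¹ l k = e a i * ∑ l, G x i l * (G x)⁻¹ l k :=
    fun i => by
      rw [Finset.mul_sum]
      exact Finset.sum_congr rfl fun l _ => by ring
  simp [ip, h2, h1]

lemma IsOrthonormal.scal_eq (he : IsOrthonormal G x e) (hG : IsMetricOn G U) (hx : x ∈ U) :
    scal G x = ∑ a, ricci G x (e a) (e a) := by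
  simp only [scal, he.inv_eq hG hx, Finset.sum_mul, ricci]
  rw [Finset.sum_congr rfl fun i _ => Finset.sum_comm, Finset.sum_comm]
  exact Finset.sum_congr rfl fun a _ => Finset.sum_congr rfl fun j _ =>
    Finset.sum_congr rfl fun k _ => by ring

namespace IsMetricOn

lemma ip_symm (hG : IsMetricOn G U) (v w : Fin n → ℝ) : ip G x v w = ip G x w v := by
  rw [ip, ip, Finset.sum_comm]
  exact Finset.sum_congr rfl fun i _ => Finset.sum_congr rfl fun j _ => by
    rw [hG.symm]; ring

lemma ip_grad (hG : IsMetricOn G U) (hx : x ∈ U) (w : Fin n → ℝ) :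
    ip G x w (grad G u x) = ∑ i, pd i u x * w i := by
  rw [ip]
  refine Finset.sum_congr rfl fun i _ => ?_
  rw [← hG.sum_metric_grad hx, Finset.sum_mul]
  exact Finset.sum_congr rfl fun j _ => by ring

/-- Every other term of the Einstein equation is symmetric, so the first Bianchi identity is not
needed. -/
lemma ricciComp_symm_of_einstein (hG : IsMetricOn G U) (hu : ContDiffOn ℝ ∞ u U)
    (hE : EinsteinOn G u lam m U) (hx : x ∈ U) (i j : Fin n) :
    ricciComp G i j x = ricciComp G j i x := by
  have h1 := hE x hx i j
  have h2 := hE x hx j i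
  rw [hG.hessComp_symm hx hu i j, hG.symm x i j, mul_comm (pd i u x)] at h1
  linarith

lemma ricci_symm_of_einstein (hG : IsMetricOn G U) (hu : ContDiffOn ℝ ∞ u U)
    (hE : EinsteinOn G u lam m U) (hx : x ∈ U) (v w : Fin n → ℝ) :
    ricci G x v w = ricci G x w v := by
  rw [ricci, ricci, Finset.sum_comm]
  exact Finset.sum_congr rfl fun i _ => Finset.sum_congr rfl fun j _ => by
    rw [hG.ricciComp_symm_of_einstein hu hE hx]; ring

/-- The second fundamental form of a regular level set is `Hess u / |∇u|`. -/
lemma secondFF_eq (hG : IsMetricOn G U) (hu : ContDiffOn ℝ ∞ u U) (hx : x ∈ U)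
    (hq : 0 < ip G x (grad G u x) (grad G u x)) (v w : Fin n → ℝ) (hw : IsTangent u x w) :
    secondFF G u x v w
      = (∑ i, ∑ l, hessComp G u i l x * v i * w l) / norm G x (grad G u x) := by
  have hV : ∀ a, DifferentiableAt ℝ (fun y => grad G u y a) x := fun a =>
    differentiableAt_of_smoothOn hG.isOpen hx (hG.smooth_grad hu a)
  have hip : DifferentiableAt ℝ (fun y => ip G y (grad G u y) (grad G u y)) x :=
    differentiableAt_of_smoothOn hG.isOpen hx
      (ContDiffOn.sum fun i _ => ContDiffOn.sum fun j _ =>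
        ((hG.smooth i j).mul (hG.smooth_grad hu i)).mul (hG.smooth_grad hu j))
  have hr : DifferentiableAt ℝ (fun y => (norm G y (grad G u y))⁻¹) x :=
    (hip.sqrt hq.ne').inv (Real.sqrt_pos.2 hq).ne'
  set r := (norm G x (grad G u x))⁻¹ with hrdef
  have h1 : ∀ i k, pd i (fun y => unitNormal G u y k) x
      = pd i (fun y => grad G u y k) x * r
        + grad G u x k * pd i (fun y => (norm G y (grad G u y))⁻¹) x := fun i k => by
    rw [← pd_mul (hV k) hr]
    rfl
  have hcov : ∀ k, covDeriv G (unitNormal G u) x v k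
      = r * (∑ i, v i * covDerivComp G (grad G u) k i x)
        + grad G u x k * ∑ i, v i * pd i (fun y => (norm G y (grad G u y))⁻¹) x := fun k => by
    rw [covDeriv, Finset.mul_sum, Finset.mul_sum, ← Finset.sum_add_distrib]
    refine Finset.sum_congr rfl fun i _ => ?_
    rw [h1, covDerivComp]
    have : ∑ j, christoffel G k i j x * unitNormal G u x j
        = r * ∑ j, christoffel G k i j x * grad G u x j := by
      rw [Finset.mul_sum]
      exact Finset.sum_congr rfl fun j _ => by rw [unitNormal, div_eq_mul_inv]; ring
    rw [this]
    ring
  set d := ∑ i, v i * pd i (fun y => (norm G y (grad G u y))⁻¹) x with hd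
  -- Differentiating the factor 1/|∇u| only produces a multiple of ∇u, which is orthogonal to the
  -- tangent vector w.
  have htan : ip G x (grad G u x) w = 0 := by rw [hG.ip_symm, hG.ip_grad hx]; exact hw
  have hs : secondFF G u x v w
      = r * ∑ k, ∑ l, G x k l * (∑ i, v i * covDerivComp G (grad G u) k i x) * w l
        + d * ip G x (grad G u x) w := by
    rw [secondFF, ip, ip]
    simp only [Finset.mul_sum (a := r), Finset.mul_sum (a := d), ← Finset.sum_add_distrib]
    refine Finset.sum_congr rfl fun k _ => Finset.sum_congr rfl fun l _ => ?_
    rw [hcov]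
    ring
  rw [hs, htan, mul_zero, add_zero, div_eq_inv_mul]
  congr 1
  simp only [hG.hessComp_eq hx hu, Finset.mul_sum, Finset.sum_mul]
  calc _ = ∑ l, ∑ k, ∑ i, G x k l * (v i * covDerivComp G (grad G u) k i x) * w l :=
        Finset.sum_comm
    _ = ∑ l, ∑ i, ∑ k, G x k l * (v i * covDerivComp G (grad G u) k i x) * w l :=
        Finset.sum_congr rfl fun l _ => Finset.sum_comm
    _ = _ := by
        rw [Finset.sum_comm]
        refine Finset.sum_congr rfl fun i _ => Finset.sum_congr rfl fun l _ =>
          Finset.sum_congr rfl fun k _ => ?_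
        rw [hG.symm x k l]; ring

end IsMetricOn

end Coord
-- Assembly of the identity in a chart
namespace Coord

variable {n : ℕ} {G : EuclideanSpace ℝ (Fin n) → Matrix (Fin n) (Fin n) ℝ}
  {U : Set (EuclideanSpace ℝ (Fin n))} {x : EuclideanSpace ℝ (Fin n)}
  {u : EuclideanSpace ℝ (Fin n) → ℝ} {lam m : ℝ} {e : Fin n → Fin n → ℝ}

/-- `IsMetricOn` records only nondegeneracy; positivity at x comes from the existence of an
orthonormal basis there. -/
lemma IsOrthonormal.ip_grad_self_pos (he : IsOrthonormal G x e) (hG : IsMetricOn G U)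
    (hx : x ∈ U) (hdu : ∃ i, pd i u x ≠ 0) : 0 < ip G x (grad G u x) (grad G u x) := by
  rw [he.ip_eq]
  refine lt_of_le_of_ne (Finset.sum_nonneg fun a _ => mul_self_nonneg _) fun h0 => ?_
  obtain ⟨i, hi⟩ := hdu
  have h1 := (Finset.sum_eq_zero_iff_of_nonneg fun a _ => mul_self_nonneg _).1 h0.symm
  have h2 : grad G u x = 0 := by
    rw [he.expand (grad G u x)]
    funext j
    exact Finset.sum_eq_zero fun a ha => by rw [mul_self_eq_zero.1 (h1 a ha), zero_mul]
  apply hi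
  rw [← hG.sum_metric_grad hx, h2]
  simp

lemma IsOrthonormal.ricci_eq (he : IsOrthonormal G x e) (v w : Fin n → ℝ) :
    ricci G x v w = ∑ a, ∑ b, ricci G x (e a) (e b) * ip G x (e a) v * ip G x (e b) w :=
  he.bilin_eq (Matrix.of fun i j => ricciComp G i j x) v w

lemma IsOrthonormal.ricci_eq_right (he : IsOrthonormal G x e) (v w : Fin n → ℝ) :
    ricci G x v w = ∑ b, ricci G x v (e b) * ip G x (e b) w := by
  have : ricci G x v w = ricci G x v fun j => ∑ a, ip G x (e a) w * e a j := by
    rw [← he.expand w]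
  rw [this]
  simp only [ricci, Finset.mul_sum, Finset.sum_mul]
  rw [Finset.sum_congr rfl fun i _ => Finset.sum_comm, Finset.sum_comm]
  exact Finset.sum_congr rfl fun b _ => Finset.sum_congr rfl fun j _ =>
    Finset.sum_congr rfl fun k _ => by ring

/-- The identity of `|D|²` with the trace-free second fundamental form and the tangential
gradient of the scalar curvature, for a metric on an open subset of `ℝⁿ`. -/
theorem sum_sq_dTensor_of_einstein (hn : 3 ≤ n) (hG : IsMetricOn G U) (hu : ContDiffOn ℝ ∞ u U)
    (hm0 : m ≠ 0) (hm1 : m ≠ 1) (hE : EinsteinOn G u lam m U) (hx : x ∈ U)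
    (hdu : ∃ i, pd i u x ≠ 0) (he : IsOrthonormal G x e) (ε : Fin (n - 1) → Fin n → ℝ)
    (hε : IsOrthonormal G x ε) (hεu : ∀ a, IsTangent u x (ε a)) :
    ∑ i, ∑ j, ∑ k, dTensor G u x (e i) (e j) (e k) ^ 2
      = 2 * norm G x (grad G u x) ^ 4 / ((n : ℝ) - 2) ^ 2 *
          ∑ a, ∑ b, (secondFF G u x (ε a) (ε b)
            - (∑ d, secondFF G u x (ε d) (ε d)) / ((n : ℝ) - 1) * ip G x (ε a) (ε b)) ^ 2
        + m ^ 2 / (2 * ((n : ℝ) - 1) * ((n : ℝ) - 2) * (m - 1) ^ 2) *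
          (norm G x (grad G (scal G) x) ^ 2
            - ip G x (grad G (scal G) x) (unitNormal G u x) ^ 2) := by
  have hn' : (3 : ℝ) ≤ n := by exact_mod_cast hn
  have h1 : (n : ℝ) - 1 ≠ 0 := by linarith
  have h2 : (n : ℝ) - 2 ≠ 0 := by linarith
  have hm1' : m - 1 ≠ 0 := sub_ne_zero.2 hm1
  have hqpos := he.ip_grad_self_pos hG hx hdu
  set V := grad G u x with hV
  set R : Fin n → Fin n → ℝ := fun a b => ricci G x (e a) (e b) with hRdef
  set v : Fin n → ℝ := fun a => ip G x (e a) V with hv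
  set c : Fin (n - 1) → Fin n → ℝ := fun α a => ip G x (e a) (ε α) with hc
  set w := norm G x V with hw
  have hip : ip G x V V = ∑ a, v a ^ 2 := by
    rw [he.ip_eq]
    exact Finset.sum_congr rfl fun a _ => (sq _).symm
  have hw2 : w ^ 2 = ∑ a, v a ^ 2 := by rw [hw, norm, Real.sq_sqrt hqpos.le, hip]
  have hq : ∑ a, v a ^ 2 ≠ 0 := by rw [← hip]; exact hqpos.ne'
  have hw0 : w ≠ 0 := by
    intro h
    rw [← hw2, h] at hq
    simp at hq
  have hR : ∀ a b, R a b = R b a := fun a b => hG.ricci_symm_of_einstein hu hE hx _ _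
  have hRv : ∀ a, ricci G x (e a) V = ∑ b, R a b * v b := fun a => he.ricci_eq_right _ _
  have hcc : ∀ a b, ∑ i, c a i * c b i = if a = b then 1 else 0 := fun a b => by
    rw [← hε a b, he.ip_eq]
  have hcv : ∀ a, ∑ i, c a i * v i = 0 := fun a => by
    rw [← he.ip_eq, hV, hG.ip_grad hx]
    exact hεu a
  have hT : ∀ a b, ricci G x (ε a) (ε b) = ∑ i, ∑ j, R i j * c a i * c b j := fun a b =>
    he.ricci_eq _ _
  -- On tangent vectors du ⊗ du vanishes, so Hess u reduces to λg - Ric.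
  have hff : ∀ a b, secondFF G u x (ε a) (ε b)
      = (lam * (if a = b then 1 else 0) - ∑ i, ∑ j, R i j * c a i * c b j) / w := fun a b => by
    rw [hG.secondFF_eq hu hx hqpos _ _ (hεu b), ← hT, ← hε a b]
    congr 1
    have hH : ∀ i l, hessComp G u i l x = lam * G x i l - ricciComp G i l x
        + 1 / m * (pd i u x * pd l u x) := fun i l => by linarith [hE x hx i l]
    have e1 : ∑ i, ∑ l, 1 / m * (pd i u x * pd l u x) * ε a i * ε b l
        = 1 / m * ((∑ i, pd i u x * ε a i) * ∑ l, pd l u x * ε b l) := by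
      rw [Finset.sum_mul_sum, Finset.mul_sum]
      refine Finset.sum_congr rfl fun i _ => ?_
      rw [Finset.mul_sum]
      exact Finset.sum_congr rfl fun l _ => by ring
    have e2 : ∑ l, pd l u x * ε b l = 0 := hεu b
    simp only [hH, add_mul, sub_mul, Finset.sum_add_distrib, Finset.sum_sub_distrib, e1, e2,
      mul_zero, add_zero]
    simp only [ip, ricci, Finset.mul_sum, mul_assoc]
  have hD : ∀ i j k, dTensor G u x (e i) (e j) (e k)
      = 1 / (((n : ℝ) - 1) * ((n : ℝ) - 2)) *
        ((∑ l, R i l * v l) * (if j = k then 1 else 0)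
          - (∑ l, R j l * v l) * (if i = k then 1 else 0))
      + 1 / ((n : ℝ) - 2) * (R j k * v i - R i k * v j)
      - (∑ l, R l l) / (((n : ℝ) - 1) * ((n : ℝ) - 2)) *
        (v i * (if j = k then 1 else 0) - v j * (if i = k then 1 else 0)) := fun i j k => by
    rw [dTensor, hRv, hRv, he, he, he.scal_eq hG hx]
  set s : Fin n → ℝ := fun a => ip G x (e a) (grad G (scal G) x) with hs
  -- Frame components of ∇scal: a multiple of Rv plus a multiple of v.
  have hsv : ∀ a, s a = 2 * ((m - 1) / m * (∑ b, R a b * v b)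
      + (scal G x - (n - 1) * lam) / m * v a) := fun a => by
    have h3 : ∀ i, pd i (scal G) x * e a i = 2 * ((m - 1) / m
        * ((∑ l, ricciComp G i l x * V l) * e a i)
        + (scal G x - (n - 1) * lam) / m * (pd i u x * e a i)) := fun i => by
      have := hG.pd_scal_of_einstein hu hm0 hE hx i
      linear_combination 2 * e a i * this
    rw [hs, ← hRv]
    dsimp only
    rw [hG.ip_grad hx, Finset.sum_congr rfl fun i _ => h3 i, ← Finset.mul_sum,
      Finset.sum_add_distrib, ← Finset.mul_sum, ← Finset.mul_sum, hv]
    dsimp only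
    rw [hV, hG.ip_grad hx, ricci]
    congr 4
    funext i
    rw [Finset.sum_mul]
    exact Finset.sum_congr rfl fun l _ => by ring
  have hgS : norm G x (grad G (scal G) x) ^ 2 = ∑ a, s a ^ 2 := by
    have : ip G x (grad G (scal G) x) (grad G (scal G) x) = ∑ a, s a ^ 2 := by
      rw [he.ip_eq]
      exact Finset.sum_congr rfl fun a _ => (sq _).symm
    rw [norm, Real.sq_sqrt (by rw [this]; positivity), this]
  have hgN : ip G x (grad G (scal G) x) (unitNormal G u x) ^ 2
      = (∑ a, s a * v a) ^ 2 / ∑ a, v a ^ 2 := by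
    have : ip G x (grad G (scal G) x) (unitNormal G u x) = (∑ a, s a * v a) / w := by
      rw [← he.ip_eq, ip, ip, Finset.sum_div]
      refine Finset.sum_congr rfl fun i _ => ?_
      rw [Finset.sum_div]
      exact Finset.sum_congr rfl fun j _ => by rw [unitNormal]; ring
    rw [this, div_pow, hw2]
  -- The λ term is pure trace on the (n-1)-dimensional tangent space, so it disappears and only the
  -- trace-free part of Ric remains.
  have hh : ∀ a b, secondFF G u x (ε a) (ε b)
      - (∑ d, secondFF G u x (ε d) (ε d)) / ((n : ℝ) - 1) * ip G x (ε a) (ε b)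
      = -((∑ i, ∑ j, R i j * c a i * c b j)
            - (∑ d, ∑ i, ∑ j, R i j * c d i * c d j) / ((n : ℝ) - 1)
              * (if a = b then 1 else 0)) / w := fun a b => by
    have hcard : ((n - 1 : ℕ) : ℝ) = (n : ℝ) - 1 := by
      rw [Nat.cast_sub (by omega), Nat.cast_one]
    simp only [hff, hε a b, if_true, ← Finset.sum_div, Finset.sum_sub_distrib, Finset.sum_const,
      Finset.card_univ, Fintype.card_fin, nsmul_eq_mul, hcard]
    field_simp
    ring
  simp only [hD, hh, hgS, hgN, div_pow, neg_sq, ← Finset.sum_div]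
  rw [sum_sq_dTensor_frame hn R hR v hq c hcc hcv]
  generalize (∑ a, ∑ b, ((∑ i, ∑ j, R i j * c a i * c b j)
            - (∑ d, ∑ i, ∑ j, R i j * c d i * c d j) / ((n : ℝ) - 1)
              * (if a = b then (1 : ℝ) else 0)) ^ 2) = Y
  -- The κ term of ∇scal is along v, so it cancels in |s|² - ⟨s, v⟩²/|v|².
  set κ := (scal G x - (n - 1) * lam) / m with hκ
  have b1 : ∑ a, s a ^ 2 = 4 * (((m - 1) / m) ^ 2 * ∑ i, (∑ l, R i l * v l) ^ 2
      + 2 * ((m - 1) / m) * κ * (∑ i, v i * ∑ l, R i l * v l) + κ ^ 2 * ∑ i, v i ^ 2) := by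
    rw [Finset.mul_sum, Finset.mul_sum, Finset.mul_sum, ← Finset.sum_add_distrib,
      ← Finset.sum_add_distrib, Finset.mul_sum]
    exact Finset.sum_congr rfl fun a _ => by rw [hsv]; ring
  have b2 : ∑ a, s a * v a = 2 * ((m - 1) / m * (∑ i, v i * ∑ l, R i l * v l)
      + κ * ∑ i, v i ^ 2) := by
    rw [Finset.mul_sum, Finset.mul_sum, ← Finset.sum_add_distrib, Finset.mul_sum]
    exact Finset.sum_congr rfl fun a _ => by rw [hsv]; ring
  rw [b1, b2, show w ^ 4 = (w ^ 2) ^ 2 by ring, hw2]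
  generalize (∑ i, (∑ l, R i l * v l) ^ 2) = P
  generalize (∑ i, v i * ∑ l, R i l * v l) = r
  generalize (∑ i, v i ^ 2) = q at *
  field_simp
  ring

end Coord

end

/-- At a regular point `p` of `f`, computed in an arbitrary smooth chart `φ` around `p`
(`G`, `u`, `x` are the metric, the function `f` and the point `p` in that chart), with `e` an
orthonormal frame of `T_p M` and `ε` an orthonormal frame of the tangent space at `p` of the
level set of `f` through `p`; `σ` is the mean curvature divided by `n - 1`. -/
theorem lemma3p2 {n : ℕ} (hn : 3 ≤ n) {M : Type*} [TopologicalSpace M]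
    [ChartedSpace (EuclideanSpace ℝ (Fin n)) M] [IsManifold (𝓡 n) ∞ M]
    (g : Bundle.ContMDiffRiemannianMetric (𝓡 n) ∞ (EuclideanSpace ℝ (Fin n))
      (fun q : M => TangentSpace (𝓡 n) q))
    (f : M → ℝ) (hf : ContMDiff (𝓡 n) 𝓘(ℝ) ∞ f)
    (lam m : ℝ) (hm0 : m ≠ 0) (hm1 : m ≠ 1)
    (hE : SatisfiesEinsteinEquation g f lam m)
    (p : M) (hp : mfderiv (𝓡 n) 𝓘(ℝ) f p ≠ 0)
    (φ : OpenPartialHomeomorph M (EuclideanSpace ℝ (Fin n)))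
    (hφ : φ ∈ IsManifold.maximalAtlas (𝓡 n) ∞ M) (hpφ : p ∈ φ.source) :
    let G := metricInChart g φ
    let u := f ∘ φ.symm
    let x := φ p
    ∀ (e : Fin n → Fin n → ℝ) (ε : Fin (n - 1) → Fin n → ℝ),
      Coord.IsOrthonormal G x e →
      Coord.IsOrthonormal G x ε → (∀ a, Coord.IsTangent u x (ε a)) →
      let h : Fin (n - 1) → Fin (n - 1) → ℝ := fun a b => Coord.secondFF G u x (ε a) (ε b)
      let H : ℝ := ∑ a, h a a
      let σ : ℝ := H / ((n : ℝ) - 1)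
      ∑ i, ∑ j, ∑ k, Coord.dTensor G u x (e i) (e j) (e k) ^ 2
        = 2 * Coord.norm G x (Coord.grad G u x) ^ 4 / ((n : ℝ) - 2) ^ 2 *
            ∑ a, ∑ b, (h a b - σ * Coord.ip G x (ε a) (ε b)) ^ 2
          + m ^ 2 / (2 * ((n : ℝ) - 1) * ((n : ℝ) - 2) * (m - 1) ^ 2) *
            (Coord.norm G x (Coord.grad G (Coord.scal G) x) ^ 2
              - Coord.ip G x (Coord.grad G (Coord.scal G) x) (Coord.unitNormal G u x) ^ 2) := by
  intro G u x e ε he hε hεu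
  have hx : x ∈ φ.target := φ.map_source hpφ
  have hG : Coord.IsMetricOn G φ.target :=
    { isOpen := φ.open_target
      smooth := matSmoothOn_metricInChart g hφ
      symm := fun y i j => metricInChart_symm g y i j
      det_ne_zero := fun y hy => (metricInChart_posDef g hφ hy).det_pos.ne' }
  exact Coord.sum_sq_dTensor_of_einstein hn hG (contDiffOn_comp_chart_symm hf hφ) hm0 hm1
    (fun y hy i j => hE φ hφ y hy i j) hx (exists_pd_ne_zero hf hφ hpφ hp) he ε hε hεu
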